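/- Let $E$ be a finite-dimensional real Euclidean space with scalar product $\langle\cdot,\cdot\rangle$, let $R\subset E$ be a reduced crystallographic root system spanning $E$ (the root system of a semisimple Lie algebra) whose reflections are isometries of $E$, and let $\alpha_1,\dots,\alpha_n$ be a base of simple roots. Put $\alpha^\vee=2\alpha/\langle\alpha,\alpha\rangle$. Let $W$ be the Weyl group generated by the simple reflections $r_{\alpha_i}$, and let $W^{\rm aff}$ be the affine Weyl group generated by the $r_{\alpha_i}$ and by $r_0x=r_\xi x+\xi^\vee$, where $\xi$ is the highest root (if $R$ is reducible, one such generator is taken for the highest root of each irreducible component). Let $$F=\{x\in E:\ \langle x,\alpha_i\rangle>0\ (1\le i\le n),\ \langle x,\xi\rangle<1\ \text{for every highest root }\xi\},$$ the fundamental domain of $W^{\rm aff}$, let $P^+_+=\{\lambda\in E:\langle\lambda,\alpha_i^\vee\rangle\in\mathbb Z_{>0}\ (1\le i\le n)\}$, and for $\lambda\in P^+_+$ let $$\varphi_\lambda(x)=\sum_{w\in W}(\det w)\,e^{2\pi \mathrm i\langle w\lambda,x\rangle},\qquad x\in E.$$ Then the following hold. (1) With respect to Lebesgue measure, for all $\lambda,\lambda'\in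 P^+_+$, $$|F|^{-1}\int_F\varphi_\lambda(x)\overline{\varphi_{\lambda'}(x)}\,dx=|W|\,\delta_{\lambda\lambda'}.$$ From now on let $dx$ be Lebesgue measure rescaled so that the torus $E/Q^\vee$, $Q^\vee=\bigoplus_i\mathbb Z\alpha_i^\vee$, has volume $1$. (2) $|F|=|W|^{-1}$ and $\int_F\varphi_\lambda\overline{\varphi_{\lambda'}}\,dx=\delta_{\lambda\lambda'}$ for all $\lambda,\lambda'\in P^+_+$. (3) Let $f:E\to\mathbb C$ be a $C^\infty$ function that is anti-invariant under $W^{\rm aff}$, i.e. $f(gx)=(\det g)f(x)$ for all $g\in W^{\rm aff}$ and $x\in E$, where $\det g$ is the determinant of the linear part of $g$, and that vanishes on $\partial F$. Then $f|_F\in L^2(F)$ and, with $c_\lambda=\int_F f(x)\overline{\varphi_\lambda(x)}\,dx$, $$f(x)=\sum_{\lambda\in P^+_+}c_\lambda\varphi_\lambda(x)\quad\text{for every }x\in E,\qquad \sum_{\lambda\in P^+_+}|c_\lambda|^2=\int_F|f(x)|^2\,dx,$$ where the first series converges unconditionally at each point $x$. (4) Let $\mathcal L^2_0(F)$ be the closure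 in $L^2(F)$ of the space of continuous functions on $\overline F$ that vanish on $\partial F$. The functions $\varphi_\lambda$, $\lambda\in P^+_+$, form an orthogonal (in the normalization of (2), orthonormal) Hilbert basis of $\mathcal L^2_0(F)$. -/

import Mathlib

open MeasureTheory Set
open scoped ContDiff ENNReal InnerProductSpace ComplexConjugate

noncomputable section

namespace OrbitFunction

variable {ι E N : Type*} [NormedAddCommGroup E] [InnerProductSpace ℝ E]
  [AddCommGroup N] [Module ℝ N] {P : RootPairing ι ℝ E N}

/-- The coroot `α^∨ = 2 α / ⟨α, α⟩`, as a vector of the Euclidean space `E`. -/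
def corootVec (P : RootPairing ι ℝ E N) (i : ι) : E :=
  (2 / ⟪P.root i, P.root i⟫_ℝ) • P.root i

/-- The Weyl group `W`, generated by the simple reflections, as a group of linear
transformations of `E`. -/
def weyl (b : P.Base) : Subgroup (E ≃ₗ[ℝ] E) :=
  Subgroup.closure (P.reflection '' (b.support : Set ι))

/-- The root with index `ξ` is a highest root: no other root exceeds it by a sum of simple roots.
An irreducible root system has exactly one such root; in general there is one for each
irreducible component. -/
def IsHighestRoot (b : P.Base) (ξ : ι) : Prop :=
  ∀ j, P.root j - P.root ξ ∈ AddSubmonoid.closure (P.root '' (b.support : Set ι)) → j = ξ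

/-- The affine reflection `r₀ x = r_ξ x + ξ^∨`. -/
def affineReflection (P : RootPairing ι ℝ E N) (ξ : ι) : E ≃ᵃ[ℝ] E :=
  (P.reflection ξ).toAffineEquiv.trans (AffineEquiv.constVAdd ℝ E (corootVec P ξ))

/-- The affine Weyl group, generated by the simple reflections and by `r₀`
(one `r₀` for each highest root). -/
def affineWeyl (b : P.Base) : Subgroup (E ≃ᵃ[ℝ] E) :=
  Subgroup.closure
    ((fun i => (P.reflection i).toAffineEquiv) '' (b.support : Set ι) ∪
      affineReflection P '' {ξ | IsHighestRoot b ξ})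

/-- Anti-invariance under the affine Weyl group: `f (g x) = (det g) f x`, where `det g` is the
determinant of the linear part of `g`. -/
def IsAntiInvariant (b : P.Base) (f : E → ℂ) : Prop :=
  ∀ g ∈ affineWeyl b, ∀ x, f (g x) = ((LinearMap.det (g.linear : E →ₗ[ℝ] E) : ℝ) : ℂ) * f x

/-- The fundamental domain `F` of the affine Weyl group: the open simplex (in the reducible case:
the product of open simplices) cut out by the walls `⟨x, α_i⟩ = 0` and `⟨x, ξ⟩ = 1`. -/
def fundDomain (b : P.Base) : Set E :=
  {x | (∀ i ∈ b.support, 0 < ⟪x, P.root i⟫_ℝ) ∧ ∀ ξ, IsHighestRoot b ξ → ⟪x, P.root ξ⟫_ℝ < 1}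

/-- The set `P^+_+` of strictly dominant integral weights. -/
def strictWeights (b : P.Base) : Set E :=
  {μ | ∀ i ∈ b.support, ∃ m : ℕ, 0 < m ∧ ⟪μ, corootVec P i⟫_ℝ = m}

/-- The antisymmetric orbit function `φ_μ(x) = ∑_{w ∈ W} (det w) exp(2πi ⟨w μ, x⟩)`
(the Weyl group is finite). -/
def orbitFun (b : P.Base) (μ x : E) : ℂ :=
  ∑ᶠ w : weyl b, ((LinearMap.det ((w : E ≃ₗ[ℝ] E) : E →ₗ[ℝ] E) : ℝ) : ℂ) *
    Complex.exp (2 * Real.pi * Complex.I * (⟪(w : E ≃ₗ[ℝ] E) μ, x⟫_ℝ : ℂ))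

variable [FiniteDimensional ℝ E] [MeasurableSpace E] [BorelSpace E]

/-- Lebesgue measure on `E`, rescaled so that the torus `E / Q^∨` has volume one, that is, so that
the parallelepiped spanned by the simple coroots has measure one. -/
def normMeasure (b : P.Base) : Measure E :=
  (volume (parallelepiped fun i : b.support => corootVec P i))⁻¹ • volume

/-- The normalized measure on `F`. -/
def domMeasure (b : P.Base) : Measure E := (normMeasure b).restrict (fundDomain b)

/-- The coefficient `c_μ = ∫_F f(x) conj (φ_μ(x)) dx`. -/
def coeff (b : P.Base) (f : E → ℂ) (μ : E) : ℂ :=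
  ∫ x, f x * conj (orbitFun b μ x) ∂(domMeasure b)

/-- The Hilbert space `L²₀(F)`: the closure, in `L²(F)`, of the continuous functions on the closed
domain that vanish on its boundary. -/
def L20 (b : P.Base) : Submodule ℂ (Lp ℂ 2 (domMeasure b)) :=
  (Submodule.span ℂ {g : Lp ℂ 2 (domMeasure b) | ∃ f : E → ℂ,
    ContinuousOn f (closure (fundDomain b)) ∧ (∀ x ∈ frontier (fundDomain b), f x = 0) ∧
      g =ᵐ[domMeasure b] f}).topologicalClosure

end OrbitFunction

end

noncomputable section

namespace OrbitFunction

/-! The affine Weyl group is the semidirect product of `W` and the translations by `Q^∨`, and `F` is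
a fundamental domain for it up to null sets. So the torus `E/Q^∨` is tiled, up to a null set, by the
`|W|` isometric copies `wF`. This gives `|F| = 1/|W|` (`normMeasure_fundDomain`) and unfolds
integrals over the torus onto `F` (`setIntegral_cell_eq_sum`). For anti-invariant `f`, unfolding the
integral of `f` against `exp(-2πi⟨μ,x⟩)` yields exactly `∫_F f conj(φ_μ)`, so orbit coefficients are
ordinary Fourier coefficients (`coeff_eq_fourierCoef`). Orthonormality reduces to that of
characters, because `W` acts freely on strictly dominant weights and each orbit contains at most one
of them (`coeff_orbitFun`).

The tiling has two halves. Every orbit meets the closed domain: a point of the orbit nearest to an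
interior point of `F` lies on the right side of every wall (`exists_affineWeyl_nonneg`). The action
is free on the open domain: a word in the wall reflections that maps a point of `F` into `F` can be
shortened until it is empty (`exists_shorter_word`, `affineWeyl_eq_one`).

For completeness, take `ψ` with compact support in `F`, periodize it, approximate it uniformly by
trigonometric polynomials and antisymmetrize over `W`. On `F` this returns `ψ` on one side and
combinations of the `φ_λ` on the other (`exists_orbitFun_approx`). Hence an integrable function
orthogonal to all `φ_λ` vanishes (`ae_eq_zero_of_forall_integral`), which gives the Hilbert basis
and Plancherel.

For smooth `f`, integration by parts makes the coefficients absolutely summable. The series then has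
a continuous sum with the coefficients of `f`, so it equals `f` on `F`, and by symmetry and
continuity everywhere (`hasSum_orbitFun`). -/

/-- The reflections of the root system are isometries of the ambient Euclidean space. -/
class IsEuclidean {ι E N : Type*} [NormedAddCommGroup E] [InnerProductSpace ℝ E]
    [AddCommGroup N] [Module ℝ N] (P : RootPairing ι ℝ E N) : Prop where
  inner_reflection : ∀ (i : ι) (x y : E), ⟪P.reflection i x, P.reflection i y⟫_ℝ = ⟪x, y⟫_ℝ

/-! ### Roots, coroots and the Weyl group in Euclidean terms. -/

section Algebra

variable {ι E N : Type*} [NormedAddCommGroup E] [InnerProductSpace ℝ E]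
  [AddCommGroup N] [Module ℝ N] {P : RootPairing ι ℝ E N}

lemma inner_root_self_pos (i : ι) : 0 < ⟪P.root i, P.root i⟫_ℝ :=
  real_inner_self_pos.mpr (P.ne_zero i)

lemma reflection_root_self (i : ι) : P.reflection i (P.root i) = -P.root i := by
  simp

lemma inner_root_corootVec_self (i : ι) : ⟪P.root i, corootVec P i⟫_ℝ = 2 := by
  have := (inner_root_self_pos (P := P) i).ne'
  rw [corootVec, real_inner_smul_right]; field_simp

lemma inner_corootVec_pos_iff (i : ι) (x : E) :
    0 < ⟪x, corootVec P i⟫_ℝ ↔ 0 < ⟪x, P.root i⟫_ℝ := by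
  have := inner_root_self_pos (P := P) i
  rw [corootVec, real_inner_smul_right]
  exact mul_pos_iff_of_pos_left (by positivity)

lemma inner_corootVec_nonneg_iff (i : ι) (x : E) :
    0 ≤ ⟪x, corootVec P i⟫_ℝ ↔ 0 ≤ ⟪x, P.root i⟫_ℝ := by
  have := inner_root_self_pos (P := P) i
  rw [corootVec, real_inner_smul_right]
  exact mul_nonneg_iff_of_pos_left (by positivity)

/-- The index of the opposite root. -/
lemma exists_root_neg (i : ι) : ∃ j, P.root j = -P.root i :=
  ⟨P.reflectionPerm i i, by rw [P.root_reflectionPerm, reflection_root_self]⟩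

lemma corootVec_eq_neg {i j : ι} (h : P.root j = -P.root i) : corootVec P j = -corootVec P i := by
  simp [corootVec, h]

lemma reflection_ofRoot {w : E ≃ₗ[ℝ] E} (hw : ∀ x y, ⟪w x, w y⟫_ℝ = ⟪x, y⟫_ℝ) {i j : ι}
    (h : w (P.root i) = P.root j) : w (corootVec P i) = corootVec P j := by
  rw [corootVec, map_smul, h, corootVec, ← h, hw]

lemma weyl_root {b : P.Base} {w : E ≃ₗ[ℝ] E} (hw : w ∈ weyl b) (i : ι) :
    ∃ j, w (P.root i) = P.root j := by
  -- The claim is made for `w` and `w⁻¹` together, so that the inverse case of the induction is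
  -- immediate.
  suffices ∀ i, (∃ j, w (P.root i) = P.root j) ∧ ∃ j, w⁻¹ (P.root i) = P.root j from (this i).1
  induction hw using Subgroup.closure_induction with
  | mem _ h =>
    obtain ⟨k, -, rfl⟩ := h
    exact fun i => ⟨⟨P.reflectionPerm k i, (P.root_reflectionPerm k i).symm⟩,
      P.reflectionPerm k i, by rw [RootPairing.reflection_inv, P.root_reflectionPerm]⟩
  | one => exact fun i => ⟨⟨i, rfl⟩, i, by simp⟩
  | mul u v _ _ hu hv =>
    intro i
    obtain ⟨j, hj⟩ := (hv i).1
    obtain ⟨k, hk⟩ := (hu j).1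
    obtain ⟨j', hj'⟩ := (hu i).2
    obtain ⟨k', hk'⟩ := (hv j').2
    exact ⟨⟨k, by rw [LinearEquiv.mul_apply, hj, hk]⟩,
      k', by rw [mul_inv_rev, LinearEquiv.mul_apply, hj', hk']⟩
  | inv u _ hu => exact fun i => ⟨(hu i).2, by simpa using (hu i).1⟩

/-- Every root is reached from simple ones by simple reflections, and the reflection in `r_j α` is
the conjugate of the reflection in `α` by `r_j`. -/
lemma reflection_mem_weyl [Finite ι] [P.IsCrystallographic] [P.IsReduced] (b : P.Base) (i : ι) :
    P.reflection i ∈ weyl b := by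
  refine b.induction_reflect i (p := fun i => P.reflection i ∈ weyl b) (fun i h => ?_)
    (fun i h => Subgroup.subset_closure ⟨i, h, rfl⟩) (fun i j h hj => ?_)
  · rw [RootPairing.reflection_reflectionPerm]
    exact mul_mem (mul_mem h h) h
  · have : P.reflection j ∈ weyl b := Subgroup.subset_closure ⟨j, hj, rfl⟩
    rw [RootPairing.reflection_reflectionPerm]
    exact mul_mem (mul_mem this h) this

lemma det_reflection [FiniteDimensional ℝ E] (i : ι) :
    LinearMap.det (P.reflection i : E →ₗ[ℝ] E) = -1 := by
  have : (P.reflection i : E →ₗ[ℝ] E) = LinearMap.transvection (-P.coroot' i) (P.root i) := by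
    ext x
    simp [RootPairing.reflection_apply, LinearMap.transvection.apply, sub_eq_add_neg]
  rw [this, LinearMap.transvection.det]
  simp; norm_num

lemma weyl_det [FiniteDimensional ℝ E] {b : P.Base} {w : E ≃ₗ[ℝ] E} (hw : w ∈ weyl b) :
    LinearMap.det (w : E →ₗ[ℝ] E) = 1 ∨ LinearMap.det (w : E →ₗ[ℝ] E) = -1 := by
  induction hw using Subgroup.closure_induction with
  | mem _ h => obtain ⟨k, -, rfl⟩ := h; exact Or.inr (det_reflection k)
  | one => exact Or.inl (by simp)
  | mul u v _ _ hu hv =>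
    rcases hu with hu | hu <;> rcases hv with hv | hv <;> simp [hu, hv]
  | inv u _ hu =>
    have : LinearMap.det ((u⁻¹ : E ≃ₗ[ℝ] E) : E →ₗ[ℝ] E) *
        LinearMap.det (u : E →ₗ[ℝ] E) = 1 := by
      rw [← map_mul, ← LinearMap.det_id (M := E)]
      congr 1
      ext x
      simp
    rcases hu with hu | hu <;> rw [hu] at this
    · left; linarith
    · right; linarith

/-- The simple coroots form a basis of the Euclidean space. -/
def corootBasis [P.IsRootSystem] (b : P.Base) : Module.Basis b.support ℝ E :=
  b.toWeightBasis.isUnitSMul (w := fun i => 2 / ⟪P.root i, P.root i⟫_ℝ) fun i =>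
    (div_pos two_pos (inner_root_self_pos (P := P) i)).ne'.isUnit

@[simp] lemma corootBasis_apply [P.IsRootSystem] (b : P.Base) (i : b.support) :
    corootBasis b i = corootVec P i := by
  simp [corootBasis, corootVec, Module.Basis.isUnitSMul_apply]

/-- The coroot lattice `Q^∨`. -/
def corootLattice [P.IsRootSystem] (b : P.Base) : Submodule ℤ E := Submodule.span ℤ (range (corootBasis b))

variable [IsEuclidean P]

/-- The bridge from the abstract pairing to the scalar product: writing `r x = x - c α`, isometry
gives `⟨x - c α, -α⟩ = ⟨x, α⟩`, which determines `c`. -/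
lemma coroot'_eq_inner (i : ι) (x : E) : P.coroot' i x = ⟪x, corootVec P i⟫_ℝ := by
  have h := IsEuclidean.inner_reflection (P := P) i x (P.root i)
  have hpos := inner_root_self_pos (P := P) i
  rw [reflection_root_self, RootPairing.reflection_apply, inner_sub_left, inner_neg_right,
    inner_neg_right, real_inner_smul_left] at h
  rw [corootVec, real_inner_smul_right]
  field_simp
  linarith

lemma reflection_apply_eq (i : ι) (x : E) :
    P.reflection i x = x - ⟪x, corootVec P i⟫_ℝ • P.root i := by
  rw [RootPairing.reflection_apply, coroot'_eq_inner]

lemma reflection_apply_eq' (i : ι) (x : E) :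
    P.reflection i x = x - ⟪x, P.root i⟫_ℝ • corootVec P i := by
  rw [reflection_apply_eq, corootVec, real_inner_smul_right, smul_smul, mul_comm]

lemma inner_root_corootVec (i j : ι) : ⟪P.root i, corootVec P j⟫_ℝ = P.pairing i j := by
  rw [← coroot'_eq_inner]; simp

lemma inner_root_corootVec_int [P.IsCrystallographic] (i j : ι) :
    ⟪P.root i, corootVec P j⟫_ℝ = (P.pairingIn ℤ i j : ℤ) := by
  rw [inner_root_corootVec, ← P.algebraMap_pairingIn ℤ]; rfl

lemma weyl_inner {b : P.Base} {w : E ≃ₗ[ℝ] E} (hw : w ∈ weyl b) (x y : E) :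
    ⟪w x, w y⟫_ℝ = ⟪x, y⟫_ℝ := by
  induction hw using Subgroup.closure_induction generalizing x y with
  | mem _ h => obtain ⟨i, -, rfl⟩ := h; exact IsEuclidean.inner_reflection i x y
  | one => rfl
  | mul u v _ _ hu hv => simp only [LinearEquiv.mul_apply, hu, hv]
  | inv u _ hu => rw [← hu]; simp

lemma weyl_inner_left {b : P.Base} {w : E ≃ₗ[ℝ] E} (hw : w ∈ weyl b) (x y : E) :
    ⟪w x, y⟫_ℝ = ⟪x, w⁻¹ y⟫_ℝ := by
  conv_lhs => rw [← weyl_inner (inv_mem hw)]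
  simp [← LinearEquiv.mul_apply]

lemma weyl_corootVec {b : P.Base} {w : E ≃ₗ[ℝ] E} (hw : w ∈ weyl b) (i : ι) :
    ∃ j, w (corootVec P i) = corootVec P j := by
  obtain ⟨j, hj⟩ := weyl_root hw i
  exact ⟨j, reflection_ofRoot (weyl_inner hw) hj⟩

/-- An element of `W` permutes the roots and is determined by this action, since the simple roots
span. -/
instance weyl_finite [Finite ι] [P.IsRootSystem] (b : P.Base) : Finite (weyl b) := by
  choose f hf using fun w : weyl b => weyl_root w.2
  refine Finite.of_injective f fun u v huv => ?_
  refine Subtype.ext (LinearEquiv.toLinearMap_injective ?_)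
  refine b.toWeightBasis.ext fun i => ?_
  simp [hf, huv]

/-- Integrality of coroots over simple coroots is known in the abstract dual `N`; `key` transports
it to `E`, representing each functional by a lattice vector. -/
lemma corootVec_mem_corootLattice [P.IsRootSystem] (b : P.Base) (j : ι) :
    corootVec P j ∈ corootLattice b := by
  have key : ∀ n ∈ Submodule.span ℤ (P.coroot '' b.support),
      ∃ q ∈ corootLattice b, ∀ x : E, P.toLinearMap x n = ⟪x, q⟫_ℝ := by
    intro n hn
    induction hn using Submodule.span_induction with
    | mem n h =>
      obtain ⟨i, hi, rfl⟩ := h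
      exact ⟨corootVec P i, Submodule.subset_span ⟨⟨i, hi⟩, by simp⟩,
        fun x => coroot'_eq_inner i x⟩
    | zero => exact ⟨0, zero_mem _, by simp⟩
    | add m n _ _ hm hn =>
      obtain ⟨q, hq, hm⟩ := hm
      obtain ⟨r, hr, hn⟩ := hn
      exact ⟨q + r, add_mem hq hr, fun x => by rw [map_add, hm, hn, inner_add_right]⟩
    | smul a n _ hn =>
      obtain ⟨r, hr, hn⟩ := hn
      refine ⟨a • r, Submodule.smul_mem _ _ hr, fun x => ?_⟩
      rw [map_zsmul, hn, ← Int.cast_smul_eq_zsmul ℝ, ← Int.cast_smul_eq_zsmul ℝ,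
        real_inner_smul_right, smul_eq_mul]
  obtain ⟨q, hq, h⟩ := key _ (b.coroot_mem_span_int j)
  convert hq
  refine ext_inner_left ℝ fun x => ?_
  rw [← h, ← coroot'_eq_inner]
  rfl

end Algebra

/-! ### Positive combinations of simple roots and highest roots. -/

section Roots

variable {ι E N : Type*} [NormedAddCommGroup E] [InnerProductSpace ℝ E]
  [AddCommGroup N] [Module ℝ N] {P : RootPairing ι ℝ E N}

lemma inner_corootLattice_int [P.IsRootSystem] {b : P.Base} {μ : E}
    (hμ : ∀ i ∈ b.support, ∃ m : ℤ, ⟪μ, corootVec P i⟫_ℝ = m) {q : E} (hq : q ∈ corootLattice b) :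
    ∃ n : ℤ, ⟪μ, q⟫_ℝ = n := by
  induction hq using Submodule.span_induction with
  | mem _ h =>
    obtain ⟨i, rfl⟩ := h
    simpa using hμ i i.2
  | zero => exact ⟨0, by simp⟩
  | add x y _ _ hx hy =>
    obtain ⟨m, hm⟩ := hx
    obtain ⟨n, hn⟩ := hy
    exact ⟨m + n, by rw [inner_add_right, hm, hn]; push_cast; rfl⟩
  | smul a x _ hx =>
    obtain ⟨m, hm⟩ := hx
    exact ⟨a * m, by rw [← Int.cast_smul_eq_zsmul ℝ, real_inner_smul_right, hm]; push_cast; rfl⟩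

/-- The nonnegative integral combinations of simple roots. -/
def posCone (b : P.Base) : AddSubmonoid E := AddSubmonoid.closure (P.root '' (b.support : Set ι))

lemma root_mem_posCone {b : P.Base} {i : ι} (hi : i ∈ b.support) : P.root i ∈ posCone b :=
  AddSubmonoid.subset_closure ⟨i, hi, rfl⟩

lemma inner_posCone_nonneg {b : P.Base} {y : E} (hy : ∀ i ∈ b.support, 0 ≤ ⟪y, P.root i⟫_ℝ)
    {m : E} (hm : m ∈ posCone b) : 0 ≤ ⟪y, m⟫_ℝ := by
  induction hm using AddSubmonoid.closure_induction with
  | mem _ h => obtain ⟨i, hi, rfl⟩ := h; exact hy i hi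
  | zero => simp
  | add x z _ _ hx hz => rw [inner_add_right]; exact add_nonneg hx hz

lemma inner_posCone_pos {b : P.Base} {y : E} (hy : ∀ i ∈ b.support, 0 < ⟪y, P.root i⟫_ℝ)
    {m : E} (hm : m ∈ posCone b) (h0 : m ≠ 0) : 0 < ⟪y, m⟫_ℝ := by
  suffices m = 0 ∨ 0 < ⟪y, m⟫_ℝ from this.resolve_left h0
  clear h0
  induction hm using AddSubmonoid.closure_induction with
  | mem _ h => obtain ⟨i, hi, rfl⟩ := h; exact Or.inr (hy i hi)
  | zero => simp
  | add x z _ _ hx hz =>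
    rw [inner_add_right]
    rcases hx with rfl | hx <;> rcases hz with rfl | hz
    · simp
    · simp [hz]
    · simp [hx]
    · right; positivity

/-- A nonnegative combination of simple roots orthogonal to a dominant vector that is singular only
for the simple root `α_i` is a multiple of `α_i`. -/
lemma posCone_eq_nsmul {b : P.Base} {y : E} {i : ι} (hi : ⟪y, P.root i⟫_ℝ = 0)
    (hy : ∀ j ∈ b.support, j ≠ i → 0 < ⟪y, P.root j⟫_ℝ)
    {m : E} (hm : m ∈ posCone b) (h0 : ⟪y, m⟫_ℝ = 0) : ∃ n : ℕ, m = n • P.root i := by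
  have hy' : ∀ j ∈ b.support, 0 ≤ ⟪y, P.root j⟫_ℝ := fun j hj => by
    rcases eq_or_ne j i with rfl | h
    exacts [hi.ge, (hy j hj h).le]
  induction hm using AddSubmonoid.closure_induction with
  | mem _ h =>
    obtain ⟨j, hj, rfl⟩ := h
    rcases eq_or_ne j i with rfl | h
    · exact ⟨1, by simp⟩
    · exact absurd h0 (hy j hj h).ne'
  | zero => exact ⟨0, by simp⟩
  | add x z hx' hz' hx hz =>
    rw [inner_add_right] at h0
    have h1 := inner_posCone_nonneg hy' hx'
    have h2 := inner_posCone_nonneg hy' hz'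
    obtain ⟨n, rfl⟩ := hx (by linarith)
    obtain ⟨k, rfl⟩ := hz (by linarith)
    exact ⟨n + k, by rw [add_smul]⟩

/-- With `c = 1` this supplies a strictly dominant vector that also measures the height of a root.
-/
lemma exists_inner_root_eq [P.IsRootSystem] [FiniteDimensional ℝ E] (b : P.Base) (c : ι → ℝ) :
    ∃ y : E, ∀ i ∈ b.support, ⟪y, P.root i⟫_ℝ = c i := by
  refine ⟨(InnerProductSpace.toDual ℝ E).symm
    (LinearMap.toContinuousLinearMap (b.toWeightBasis.constr ℝ fun i => c i)), fun i hi => ?_⟩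
  rw [InnerProductSpace.toDual_symm_apply, LinearMap.coe_toContinuousLinearMap']
  have := b.toWeightBasis.constr_basis ℝ (fun i : b.support => c i) ⟨i, hi⟩
  rwa [RootPairing.Base.toWeightBasis_apply] at this

/-- Among the finitely many roots above the given one, a root of maximal height is highest. -/
lemma exists_isHighestRoot [Finite ι] [P.IsRootSystem] [FiniteDimensional ℝ E] (b : P.Base)
    (j : ι) : ∃ ξ, IsHighestRoot b ξ ∧ P.root ξ - P.root j ∈ posCone b := by
  obtain ⟨y, hy⟩ := exists_inner_root_eq b 1
  obtain ⟨ξ, hξ, hmax⟩ := Set.exists_max_image {k | P.root k - P.root j ∈ posCone b}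
    (fun k => ⟪y, P.root k⟫_ℝ) (Set.toFinite _) ⟨j, by simp⟩
  refine ⟨ξ, fun k hk => ?_, hξ⟩
  by_contra hne
  have h1 : k ∈ {k | P.root k - P.root j ∈ posCone b} := by
    have := add_mem (show P.root k - P.root ξ ∈ posCone b from hk) hξ
    simpa using this
  have h2 := inner_posCone_pos (y := y) (fun i hi => by rw [hy i hi]; simp) hk
    (sub_ne_zero.mpr fun h => hne (P.root.injective h))
  rw [inner_sub_right] at h2
  linarith [hmax k h1]

/-- If `-ξ` were positive, then `-ξ = ξ + 2(-ξ)` would lie above `ξ`. -/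
lemma IsHighestRoot.root_mem {b : P.Base} {ξ : ι} (h : IsHighestRoot b ξ) :
    P.root ξ ∈ posCone b := by
  refine (b.root_mem_or_neg_mem ξ).resolve_right fun hn => ?_
  obtain ⟨j, hj⟩ := exists_root_neg (P := P) ξ
  have := h j (by rw [hj, sub_eq_add_neg]; exact add_mem hn hn)
  rw [this] at hj
  have := inner_root_self_pos (P := P) ξ
  have h2 : ⟪P.root ξ, P.root ξ⟫_ℝ = -⟪P.root ξ, P.root ξ⟫_ℝ := by
    nth_rw 1 [hj]
    rw [inner_neg_left]
  linarith

variable [IsEuclidean P]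

lemma weyl_mem_corootLattice [P.IsRootSystem] {b : P.Base} {w : E ≃ₗ[ℝ] E} (hw : w ∈ weyl b)
    {q : E} (hq : q ∈ corootLattice b) : w q ∈ corootLattice b := by
  induction hq using Submodule.span_induction with
  | mem _ h =>
    obtain ⟨i, rfl⟩ := h
    obtain ⟨j, hj⟩ := weyl_corootVec hw i
    rw [corootBasis_apply, hj]
    exact corootVec_mem_corootLattice b j
  | zero => simp
  | add x y _ _ hx hy => rw [map_add]; exact add_mem hx hy
  | smul a x _ hx => rw [map_zsmul]; exact Submodule.smul_mem _ _ hx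

variable [P.IsCrystallographic]

lemma inner_root_corootLattice_int [P.IsRootSystem] (b : P.Base) (i : ι) {q : E}
    (hq : q ∈ corootLattice b) : ∃ n : ℤ, ⟪P.root i, q⟫_ℝ = n :=
  inner_corootLattice_int (fun j _ => ⟨_, inner_root_corootVec_int i j⟩) hq

/-- Otherwise the reflection `r_i` would raise `ξ` by a positive multiple of `α_i`. -/
lemma IsHighestRoot.inner_nonneg {b : P.Base} {ξ : ι} (h : IsHighestRoot b ξ) {i : ι}
    (hi : i ∈ b.support) : 0 ≤ ⟪P.root ξ, P.root i⟫_ℝ := by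
  rw [← inner_corootVec_nonneg_iff, inner_root_corootVec_int]
  by_contra! hn
  have hn' : P.pairingIn ℤ ξ i < 0 := by exact_mod_cast hn
  obtain ⟨k, hk⟩ := Int.eq_ofNat_of_zero_le (a := -P.pairingIn ℤ ξ i) (by omega)
  have hr : P.root (P.reflectionPerm i ξ) - P.root ξ = k • P.root i := by
    rw [P.root_reflectionPerm, reflection_apply_eq, inner_root_corootVec_int, sub_sub_cancel_left,
      ← neg_smul, ← Int.cast_neg, hk, Int.cast_natCast, Nat.cast_smul_eq_nsmul]
  have h1 := h (P.reflectionPerm i ξ) (by rw [hr]; exact nsmul_mem (root_mem_posCone hi) k)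
  rw [h1, sub_self] at hr
  have : k ≠ 0 := by rintro rfl; omega
  rw [← Nat.cast_smul_eq_nsmul ℝ] at hr
  exact smul_ne_zero (Nat.cast_ne_zero.mpr this) (P.ne_zero i) hr.symm

/-- With a positive scalar product, `ξ - η` would be a root; being positive or negative, it would
place one of the two above the other. -/
lemma IsHighestRoot.inner_nonpos [Finite ι] {b : P.Base} {ξ η : ι} (hξ : IsHighestRoot b ξ)
    (hη : IsHighestRoot b η) (hne : ξ ≠ η) : ⟪P.root ξ, P.root η⟫_ℝ ≤ 0 := by
  by_contra! h
  rw [← inner_corootVec_pos_iff, inner_root_corootVec_int] at h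
  obtain ⟨k, hk⟩ := P.root_sub_root_mem_of_pairingIn_pos (i := ξ) (j := η) (by exact_mod_cast h) hne
  rcases b.root_mem_or_neg_mem k with h1 | h1 <;> rw [hk] at h1
  · exact hne (hη ξ h1)
  · rw [neg_sub] at h1
    exact hne (hξ η h1).symm

end Roots

/-! ### Affine roots and the walls of the fundamental domain. -/

section Affine

variable {ι E N : Type*} [NormedAddCommGroup E] [InnerProductSpace ℝ E]
  [AddCommGroup N] [Module ℝ N] {P : RootPairing ι ℝ E N}

lemma exists_smul_inner_root_lt_one [Finite ι] (P : RootPairing ι ℝ E N) (y : E) :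
    ∃ t : ℝ, 0 < t ∧ ∀ k, ⟪t • y, P.root k⟫_ℝ < 1 := by
  obtain ⟨M, hM⟩ := (Set.finite_range fun k => |⟪y, P.root k⟫_ℝ|).bddAbove
  have hM' : ∀ k, |⟪y, P.root k⟫_ℝ| ≤ M := fun k => hM ⟨k, rfl⟩
  refine ⟨(|M| + 1)⁻¹, by positivity, fun k => ?_⟩
  rw [real_inner_smul_left, inv_mul_lt_one₀ (by positivity)]
  linarith [hM' k, le_abs_self ⟪y, P.root k⟫_ℝ, le_abs_self M]

lemma fundDomain_nonempty [Finite ι] [P.IsRootSystem] [FiniteDimensional ℝ E] (b : P.Base) :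
    (fundDomain b).Nonempty := by
  obtain ⟨y, hy⟩ := exists_inner_root_eq b 1
  obtain ⟨t, ht, h⟩ := exists_smul_inner_root_lt_one P y
  refine ⟨t • y, fun i hi => ?_, fun ξ _ => h ξ⟩
  rw [real_inner_smul_left, hy i hi]
  simpa using ht

lemma fundDomain_isOpen [Finite ι] (b : P.Base) : IsOpen (fundDomain b) := by
  have : fundDomain b = (⋂ i ∈ b.support, {x | 0 < ⟪x, P.root i⟫_ℝ}) ∩
      ⋂ ξ ∈ {ξ | IsHighestRoot b ξ}, {x | ⟪x, P.root ξ⟫_ℝ < 1} := by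
    ext x; simp [fundDomain]
  rw [this]
  refine (isOpen_biInter_finset fun i _ => ?_).inter
    ((Set.toFinite _).isOpen_biInter fun ξ _ => ?_)
  · exact isOpen_lt continuous_const (by fun_prop)
  · exact isOpen_lt (by fun_prop) continuous_const

/-- The walls control all positive roots: each lies below a highest root, which is less than 1 on
`F`. Hence no affine hyperplane cuts `F`. -/
lemma root_inner_mem_Ioo [Finite ι] [P.IsRootSystem] [FiniteDimensional ℝ E] {b : P.Base} {x : E}
    (hx : x ∈ fundDomain b) {j : ι} (hj : P.root j ∈ posCone b) :
    ⟪x, P.root j⟫_ℝ ∈ Ioo (0 : ℝ) 1 := by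
  refine ⟨inner_posCone_pos hx.1 hj (P.ne_zero j), ?_⟩
  obtain ⟨ξ, hξ, h⟩ := exists_isHighestRoot b j
  have := inner_posCone_nonneg (fun i hi => (hx.1 i hi).le) h
  rw [inner_sub_right] at this
  linarith [hx.2 ξ hξ]

/-- The value at `x` of the affine root `(α_i, k)`, that is, of the function `⟨·, α_i⟩ + k`. -/
def affVal (P : RootPairing ι ℝ E N) (a : ι × ℤ) (x : E) : ℝ := ⟪x, P.root a.1⟫_ℝ + a.2

/-- The reflection in the zero set of an affine root. -/
def affRefl (P : RootPairing ι ℝ E N) (a : ι × ℤ) : E ≃ᵃ[ℝ] E :=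
  (P.reflection a.1).toAffineEquiv.trans
    (AffineEquiv.constVAdd ℝ E (-((a.2 : ℝ) • corootVec P a.1)))

/-- The simple affine roots: the walls of the fundamental domain. -/
def simpleAff (b : P.Base) : Set (ι × ℤ) :=
  {a | (a.1 ∈ b.support ∧ a.2 = 0) ∨
    ∃ ξ, IsHighestRoot b ξ ∧ P.root a.1 = -P.root ξ ∧ a.2 = 1}

lemma mem_fundDomain_iff {b : P.Base} {x : E} :
    x ∈ fundDomain b ↔ ∀ a ∈ simpleAff b, 0 < affVal P a x := by
  constructor
  · rintro hx a (⟨h1, h2⟩ | ⟨ξ, hξ, h1, h2⟩)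
    · simpa [affVal, h2] using hx.1 _ h1
    · have := hx.2 ξ hξ
      simp only [affVal, h1, h2, inner_neg_right]
      push_cast
      linarith
  · intro h
    refine ⟨fun i hi => ?_, fun ξ hξ => ?_⟩
    · simpa [affVal] using h (i, 0) (Or.inl ⟨hi, rfl⟩)
    · obtain ⟨j, hj⟩ := exists_root_neg (P := P) ξ
      have := h (j, 1) (Or.inr ⟨ξ, hξ, hj, rfl⟩)
      simp only [affVal, hj, inner_neg_right] at this
      push_cast at this
      linarith

/-- Affine roots do not change sign on the fundamental domain. -/
lemma affVal_pos_or_neg [Finite ι] [P.IsRootSystem] [FiniteDimensional ℝ E] (b : P.Base)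
    (a : ι × ℤ) :
    (∀ x ∈ fundDomain b, 0 < affVal P a x) ∨ ∀ x ∈ fundDomain b, affVal P a x < 0 := by
  obtain ⟨j, k⟩ := a
  simp only [affVal]
  rcases b.root_mem_or_neg_mem j with hj | hj
  · rcases le_or_gt 0 k with hk | hk
    · have hk' : (0 : ℝ) ≤ k := by exact_mod_cast hk
      exact Or.inl fun x hx => by linarith [(root_inner_mem_Ioo hx hj).1]
    · have hk' : (k : ℝ) ≤ -1 := by exact_mod_cast (by omega : k ≤ -1)
      exact Or.inr fun x hx => by linarith [(root_inner_mem_Ioo hx hj).2]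
  · obtain ⟨i, hi⟩ := exists_root_neg (P := P) j
    rw [← hi] at hj
    have hij : ∀ x, ⟪x, P.root i⟫_ℝ = -⟪x, P.root j⟫_ℝ := fun x => by rw [hi, inner_neg_right]
    rcases le_or_gt k 0 with hk | hk
    · have hk' : (k : ℝ) ≤ 0 := by exact_mod_cast hk
      exact Or.inr fun x hx => by linarith [(root_inner_mem_Ioo hx hj).1, hij x]
    · have hk' : (1 : ℝ) ≤ k := by exact_mod_cast (by omega : 1 ≤ k)
      exact Or.inl fun x hx => by linarith [(root_inner_mem_Ioo hx hj).2, hij x]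

lemma affVal_lineMap (a : ι × ℤ) (p y : E) (t : ℝ) :
    affVal P a ((1 - t) • p + t • y) = (1 - t) * affVal P a p + t * affVal P a y := by
  simp only [affVal, inner_add_left, real_inner_smul_left]; ring

/-- The points where all simple affine roots are nonnegative lie in the closed fundamental
domain. -/
lemma mem_closure_fundDomain [Finite ι] [P.IsRootSystem] [FiniteDimensional ℝ E] {b : P.Base}
    {p : E} (hp : ∀ s ∈ simpleAff b, 0 ≤ affVal P s p) :
    p ∈ closure (fundDomain b) := by
  obtain ⟨y, hy⟩ := fundDomain_nonempty b
  have h : Filter.Tendsto (fun t : ℝ => (1 - t) • p + t • y) (nhdsWithin 0 (Ioo 0 1)) (nhds p) := by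
    have : Continuous fun t : ℝ => (1 - t) • p + t • y := by fun_prop
    simpa using (this.tendsto 0).mono_left nhdsWithin_le_nhds
  have : (nhdsWithin (0 : ℝ) (Ioo 0 1)).NeBot :=
    left_nhdsWithin_Ioo_neBot one_pos
  refine mem_closure_of_tendsto h ?_
  filter_upwards [self_mem_nhdsWithin] with t ht
  rw [mem_fundDomain_iff]
  intro s hs
  rw [affVal_lineMap]
  have := mem_fundDomain_iff.mp hy s hs
  have := hp s hs
  have := ht.1
  have := sub_pos.mpr ht.2
  positivity

lemma continuous_affVal (a : ι × ℤ) : Continuous (affVal P a) := by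
  unfold affVal; fun_prop

/-- Supplies a point in the relative interior of the facet `⟨x, α_i⟩ = 0`, at which an affine root
can be tested. -/
lemma exists_facet_point_of_mem_support [Finite ι] [P.IsRootSystem] [FiniteDimensional ℝ E]
    {b : P.Base} (i : ι) : ∃ p : E, (i ∈ b.support → ⟪p, P.root i⟫_ℝ = 0) ∧
      (∀ j ∈ b.support, j ≠ i → 0 < ⟪p, P.root j⟫_ℝ) ∧ ∀ k, ⟪p, P.root k⟫_ℝ < 1 := by
  classical
  obtain ⟨y, hy⟩ := exists_inner_root_eq b (fun j => if j = i then 0 else 1)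
  obtain ⟨t, ht, h⟩ := exists_smul_inner_root_lt_one P y
  refine ⟨t • y, fun hi => ?_, fun j hj hji => ?_, h⟩
  · rw [real_inner_smul_left, hy i hi]; simp
  · rw [real_inner_smul_left, hy j hj]; simpa [hji] using ht

variable [IsEuclidean P]

lemma affRefl_apply (a : ι × ℤ) (x : E) :
    affRefl P a x = x - affVal P a x • corootVec P a.1 := by
  have : affRefl P a x = -((a.2 : ℝ) • corootVec P a.1) + P.reflection a.1 x := rfl
  rw [this, reflection_apply_eq', affVal, add_smul]
  abel

lemma affVal_affRefl_self (a : ι × ℤ) (x : E) : affVal P a (affRefl P a x) = -affVal P a x := by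
  rw [affRefl_apply]
  have h := inner_root_corootVec_self (P := P) a.1
  rw [real_inner_comm] at h
  simp only [affVal, inner_sub_left, real_inner_smul_left, h]
  ring

lemma affRefl_mul_self (a : ι × ℤ) : affRefl P a * affRefl P a = 1 := by
  ext x
  change affRefl P a (affRefl P a x) = x
  rw [affRefl_apply, affVal_affRefl_self, affRefl_apply, neg_smul]
  abel

/-- Reflecting `z` in a wall brings it closer to `y` exactly when the wall separates them. This
drives the distance minimization over orbits. -/
lemma norm_sub_affRefl_sq (a : ι × ℤ) (y z : E) :
    ‖y - affRefl P a z‖ ^ 2 = ‖y - z‖ ^ 2 +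
      4 / ⟪P.root a.1, P.root a.1⟫_ℝ * (affVal P a z * affVal P a y) := by
  have hpos := (inner_root_self_pos (P := P) a.1).ne'
  rw [affRefl_apply, ← sub_add, norm_add_sq_real, add_assoc, add_right_inj, norm_smul, mul_pow,
    ← real_inner_self_eq_norm_sq (corootVec P a.1), Real.norm_eq_abs, sq_abs]
  simp only [affVal, corootVec, inner_sub_left, real_inner_smul_left, real_inner_smul_right]
  field_simp
  ring

lemma exists_facet_point_of_isHighestRoot [Finite ι] [P.IsRootSystem] [P.IsCrystallographic]
    [FiniteDimensional ℝ E] {b : P.Base} {ξ : ι} (hξ : IsHighestRoot b ξ) :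
    ∃ p : E, ⟪p, P.root ξ⟫_ℝ = 1 ∧ (∀ j ∈ b.support, 0 < ⟪p, P.root j⟫_ℝ) ∧
      ∀ η, IsHighestRoot b η → η ≠ ξ → ⟪p, P.root η⟫_ℝ < 1 := by
  obtain ⟨y, hy⟩ := exists_inner_root_eq b 1
  obtain ⟨t, ht, h⟩ := exists_smul_inner_root_lt_one P y
  have hv : ∀ j ∈ b.support, 0 < ⟪t • y, P.root j⟫_ℝ := fun j hj => by
    rw [real_inner_smul_left, hy j hj]; simpa using ht
  generalize t • y = v at h hv
  have hvξ := inner_posCone_pos hv hξ.root_mem (P.ne_zero ξ)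
  have hpos := inner_root_self_pos (P := P) ξ
  -- The vector `ξ/⟨ξ, ξ⟩` is on the wall of `ξ`, nonnegative on simple roots and nonpositive on the
  -- other highest roots. Adding the small strictly dominant `v` makes the inequalities strict, and
  -- the factor restores the value 1 on `ξ`.
  refine ⟨(1 + ⟪v, P.root ξ⟫_ℝ)⁻¹ • ((⟪P.root ξ, P.root ξ⟫_ℝ)⁻¹ • P.root ξ + v), ?_, ?_, ?_⟩
  · rw [real_inner_smul_left, inner_add_left, real_inner_smul_left, inv_mul_cancel₀ hpos.ne',
      inv_mul_cancel₀ (by positivity)]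
  · intro j hj
    rw [real_inner_smul_left, inner_add_left, real_inner_smul_left]
    have := hξ.inner_nonneg hj
    have := hv j hj
    positivity
  · intro η hη hne
    rw [real_inner_smul_left, inner_add_left, real_inner_smul_left, inv_mul_lt_one₀ (by positivity)]
    have h1 := mul_nonpos_of_nonneg_of_nonpos (inv_nonneg.mpr hpos.le)
      (hξ.inner_nonpos hη hne.symm)
    linarith [h η]

end Affine

/-! ### The affine Weyl group is generated by `W` and the coroot translations. -/

section AffineGroup

variable {ι E N : Type*} [NormedAddCommGroup E] [InnerProductSpace ℝ E]
  [AddCommGroup N] [Module ℝ N] {P : RootPairing ι ℝ E N}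

/-- Choose `w` maximizing `⟨w x, y⟩` with `y` of value 1 on simple roots: a negative `⟨w x, α_i⟩`
would let `r_i` increase it. -/
lemma exists_weyl_dominant [Finite ι] [P.IsRootSystem] [FiniteDimensional ℝ E] [IsEuclidean P]
    (b : P.Base) (x : E) : ∃ w ∈ weyl b, ∀ i ∈ b.support, 0 ≤ ⟪w x, P.root i⟫_ℝ := by
  obtain ⟨y, hy⟩ := exists_inner_root_eq b 1
  obtain ⟨w, hw⟩ := Finite.exists_max fun w : weyl b => ⟪(w : E ≃ₗ[ℝ] E) x, y⟫_ℝ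
  refine ⟨w, w.2, fun i hi => ?_⟩
  have h := hw (⟨P.reflection i, Subgroup.subset_closure ⟨i, hi, rfl⟩⟩ * w)
  have h1 : ⟪P.root i, y⟫_ℝ = 1 := by rw [real_inner_comm, hy i hi]; rfl
  simp only [Subgroup.coe_mul, LinearEquiv.mul_apply, reflection_apply_eq, inner_sub_left,
    real_inner_smul_left, h1] at h
  rw [← inner_corootVec_nonneg_iff]
  linarith

/-- The affine map `x ↦ w x + q`. -/
def affMk (w : E ≃ₗ[ℝ] E) (q : E) : E ≃ᵃ[ℝ] E :=
  w.toAffineEquiv.trans (AffineEquiv.constVAdd ℝ E q)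

lemma affMk_apply (w : E ≃ₗ[ℝ] E) (q x : E) : affMk w q x = w x + q := add_comm _ _

lemma affMk_mul (v w : E ≃ₗ[ℝ] E) (q r : E) :
    affMk v q * affMk w r = affMk (v * w) (v r + q) := by
  ext x
  change affMk v q (affMk w r x) = _
  simp only [affMk_apply, map_add, LinearEquiv.mul_apply]
  abel

lemma affMk_one : affMk (1 : E ≃ₗ[ℝ] E) 0 = 1 := by
  ext x; simp [affMk_apply]

lemma linear_affMk (w : E ≃ₗ[ℝ] E) (q : E) : (affMk w q).linear = w := by
  ext x
  have := (affMk w q).map_vadd 0 x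
  simp only [affMk_apply, map_zero, vadd_eq_add, map_add] at this
  rw [add_zero, zero_add] at this
  exact (add_right_cancel this).symm

lemma affRefl_eq_affMk (a : ι × ℤ) :
    affRefl P a = affMk (P.reflection a.1) (-((a.2 : ℝ) • corootVec P a.1)) := rfl

lemma affineReflection_eq_affMk (ξ : ι) :
    affineReflection P ξ = affMk (P.reflection ξ) (corootVec P ξ) := rfl

lemma weyl_affMk_mem (b : P.Base) {w : E ≃ₗ[ℝ] E} (hw : w ∈ weyl b) :
    affMk w 0 ∈ affineWeyl b := by
  induction hw using Subgroup.closure_induction with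
  | mem _ h =>
    obtain ⟨i, hi, rfl⟩ := h
    refine Subgroup.subset_closure (Or.inl ⟨i, hi, ?_⟩)
    ext x; simp [affMk_apply]
  | one => rw [affMk_one]; exact one_mem _
  | mul u v _ _ hu hv =>
    have := mul_mem hu hv
    rwa [affMk_mul, map_zero, add_zero] at this
  | inv u _ hu =>
    have : affMk u⁻¹ 0 = (affMk u 0)⁻¹ := by
      rw [eq_inv_iff_mul_eq_one, affMk_mul, inv_mul_cancel, map_zero, add_zero, affMk_one]
    rw [this]
    exact inv_mem hu

variable [IsEuclidean P]

/-- The generator `r₀` attached to `ξ` is the reflection of the affine root `(-ξ, 1)`, so the group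
is generated by the reflections in the walls of `F`. -/
lemma affineWeyl_eq_closure (b : P.Base) :
    affineWeyl b = Subgroup.closure (affRefl P '' simpleAff b) := by
  have hneg : ∀ {j ξ : ι}, P.root j = -P.root ξ → affRefl P (j, 1) = affineReflection P ξ := by
    intro j ξ hj
    ext x
    rw [affRefl_apply, affineReflection_eq_affMk, affMk_apply, reflection_apply_eq',
      corootVec_eq_neg hj, affVal, hj, inner_neg_right]
    simp only [Int.cast_one]
    module
  have hlin : ∀ i, affRefl P (i, 0) = (P.reflection i).toAffineEquiv := by
    intro i
    ext x
    rw [affRefl_eq_affMk, affMk_apply]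
    simp
  rw [affineWeyl]
  congr 1
  ext g
  constructor
  · rintro (⟨i, hi, rfl⟩ | ⟨ξ, hξ, rfl⟩)
    · exact ⟨(i, 0), Or.inl ⟨hi, rfl⟩, hlin i⟩
    · obtain ⟨j, hj⟩ := exists_root_neg (P := P) ξ
      exact ⟨(j, 1), Or.inr ⟨ξ, hξ, hj, rfl⟩, hneg hj⟩
  · rintro ⟨⟨j, k⟩, ⟨h1, h2⟩ | ⟨ξ, hξ, h1, h2⟩, rfl⟩
    · obtain rfl : k = 0 := h2
      exact Or.inl ⟨j, h1, (hlin j).symm⟩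
    · obtain rfl : k = 1 := h2
      exact Or.inr ⟨ξ, hξ, (hneg h1).symm⟩

variable [Finite ι] [P.IsRootSystem] [P.IsCrystallographic] [P.IsReduced]

lemma affineWeyl_eq_affMk {b : P.Base} {g : E ≃ᵃ[ℝ] E} (hg : g ∈ affineWeyl b) :
    ∃ w ∈ weyl b, ∃ q ∈ corootLattice b, g = affMk w q := by
  induction hg using Subgroup.closure_induction with
  | mem _ h =>
    rcases h with ⟨i, hi, rfl⟩ | ⟨ξ, -, rfl⟩
    · refine ⟨_, reflection_mem_weyl b i, 0, zero_mem _, ?_⟩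
      ext x; simp [affMk_apply]
    · exact ⟨_, reflection_mem_weyl b ξ, _, corootVec_mem_corootLattice b ξ, rfl⟩
  | one => exact ⟨1, one_mem _, 0, zero_mem _, affMk_one.symm⟩
  | mul u v _ _ hu hv =>
    obtain ⟨w, hw, q, hq, rfl⟩ := hu
    obtain ⟨w', hw', q', hq', rfl⟩ := hv
    exact ⟨_, mul_mem hw hw', _, add_mem (weyl_mem_corootLattice hw hq') hq, affMk_mul _ _ _ _⟩
  | inv u _ hu =>
    obtain ⟨w, hw, q, hq, rfl⟩ := hu
    refine ⟨_, inv_mem hw, _, neg_mem (weyl_mem_corootLattice (inv_mem hw) hq), ?_⟩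
    rw [inv_eq_iff_mul_eq_one, affMk_mul, mul_inv_cancel, ← affMk_one]
    congr 1
    rw [map_neg, ← LinearEquiv.mul_apply, mul_inv_cancel]
    simp

variable [FiniteDimensional ℝ E]

/-- The affine Weyl group contains the translations by coroots: by conjugation it suffices to treat
dominant coroots, and these are differences of conjugates of the coroot of a highest root. -/
lemma translation_mem (b : P.Base) {q : E} (hq : q ∈ corootLattice b) :
    affMk 1 q ∈ affineWeyl b := by
  have hconj : ∀ {w : E ≃ₗ[ℝ] E} {q : E}, w ∈ weyl b → affMk 1 q ∈ affineWeyl b →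
      affMk 1 (w q) ∈ affineWeyl b := by
    intro w q hw hq
    have := mul_mem (mul_mem (weyl_affMk_mem b hw) hq) (weyl_affMk_mem b (inv_mem hw))
    rw [affMk_mul, affMk_mul] at this
    simpa using this
  have hadd : ∀ {q r : E}, affMk 1 q ∈ affineWeyl b → affMk 1 r ∈ affineWeyl b →
      affMk 1 (q + r) ∈ affineWeyl b := by
    intro q r hq hr
    have := mul_mem hr hq
    rwa [affMk_mul, mul_one] at this
  have hneg : ∀ {q : E}, affMk 1 q ∈ affineWeyl b → affMk 1 (-q) ∈ affineWeyl b := by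
    intro q hq
    have : affMk 1 (-q) = (affMk 1 q)⁻¹ := by
      rw [eq_inv_iff_mul_eq_one, affMk_mul, mul_one]
      exact (congrArg (affMk 1) (add_neg_cancel q)).trans affMk_one
    rw [this]
    exact inv_mem hq
  have hhigh : ∀ ξ, IsHighestRoot b ξ → affMk 1 (corootVec P ξ) ∈ affineWeyl b := by
    intro ξ hξ
    have h1 : affineReflection P ξ ∈ affineWeyl b := Subgroup.subset_closure (Or.inr ⟨ξ, hξ, rfl⟩)
    have := mul_mem h1 (weyl_affMk_mem b (inv_mem (reflection_mem_weyl b ξ)))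
    rw [affineReflection_eq_affMk, affMk_mul, mul_inv_cancel, map_zero, zero_add] at this
    exact this
  have hdom : ∀ j, (∀ i ∈ b.support, 0 ≤ ⟪P.root j, P.root i⟫_ℝ) →
      affMk 1 (corootVec P j) ∈ affineWeyl b := by
    intro j hj
    obtain ⟨ξ, hξ, hle⟩ := exists_isHighestRoot b j
    rcases eq_or_ne j ξ with rfl | hne
    · exact hhigh _ hξ
    have h1 := inner_posCone_nonneg hj hle
    have h2 := inner_posCone_nonneg (fun i hi => hξ.inner_nonneg hi) hle
    have hjj := inner_root_self_pos (P := P) j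
    have hξξ := inner_root_self_pos (P := P) ξ
    rw [inner_sub_right] at h1 h2
    have hc := real_inner_comm (P.root j) (P.root ξ)
    have hp : ⟪P.root j, corootVec P ξ⟫_ℝ * ⟪P.root ξ, P.root ξ⟫_ℝ
        = 2 * ⟪P.root j, P.root ξ⟫_ℝ := by
      rw [corootVec, real_inner_smul_right]; field_simp
    -- Equality would give `‖α_j - ξ‖² = ⟨α_j, α_j⟩ - ⟨ξ, ξ⟩ ≤ 0`.
    have hlt : ⟪P.root j, P.root ξ⟫_ℝ < ⟪P.root ξ, P.root ξ⟫_ℝ := by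
      refine lt_of_le_of_ne (by linarith) fun h => hne ?_
      have : ⟪P.root j - P.root ξ, P.root j - P.root ξ⟫_ℝ ≤ 0 := by
        simp only [inner_sub_left, inner_sub_right]; linarith
      exact P.root.injective (sub_eq_zero.mp (by
        by_contra h0
        exact this.not_gt (real_inner_self_pos.mpr h0)))
    rw [inner_root_corootVec_int] at hp
    -- The integer `⟨α_j, ξ^∨⟩` lies strictly between 0 and 2. Being 1, it gives `r_j ξ^∨ = ξ^∨ -
    -- α_j^∨`, so `α_j^∨` is a difference of two translations already obtained.
    have hone : P.pairingIn ℤ j ξ = 1 := by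
      have h3 : (0 : ℝ) < (P.pairingIn ℤ j ξ : ℤ) := by
        by_contra! h
        have := mul_nonpos_of_nonpos_of_nonneg h hξξ.le
        linarith
      have h4 : ((P.pairingIn ℤ j ξ : ℤ) : ℝ) < 2 := by
        by_contra! h
        have := mul_le_mul_of_nonneg_right h hξξ.le
        linarith
      have h3' : 0 < P.pairingIn ℤ j ξ := by exact_mod_cast h3
      have h4' : P.pairingIn ℤ j ξ < 2 := by exact_mod_cast h4
      omega
    have hrefl : P.reflection j (corootVec P ξ) = corootVec P ξ - corootVec P j := by
      rw [reflection_apply_eq', real_inner_comm, inner_root_corootVec_int, hone]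
      simp
    have := hadd (hhigh ξ hξ) (hneg (hconj (reflection_mem_weyl b j) (hhigh ξ hξ)))
    rwa [hrefl, neg_sub, add_sub_cancel] at this
  have hall : ∀ j, affMk 1 (corootVec P j) ∈ affineWeyl b := by
    intro j
    obtain ⟨w, hw, h⟩ := exists_weyl_dominant b (P.root j)
    obtain ⟨k, hk⟩ := weyl_root hw j
    have h1 := hconj (inv_mem hw) (hdom k (by rwa [← hk]))
    rw [← reflection_ofRoot (weyl_inner hw) hk, ← LinearEquiv.mul_apply, inv_mul_cancel] at h1
    simpa using h1
  let T : AddSubgroup E :=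
    { carrier := {q | affMk 1 q ∈ affineWeyl b}
      add_mem' := hadd
      zero_mem' := by
        change affMk 1 (0 : E) ∈ affineWeyl b
        rw [affMk_one]
        exact one_mem _
      neg_mem' := hneg }
  have : corootLattice b ≤ AddSubgroup.toIntSubmodule T := by
    refine Submodule.span_le.mpr ?_
    rintro _ ⟨i, rfl⟩
    rw [corootBasis_apply]
    exact hall i
  exact this hq

lemma affMk_mem (b : P.Base) {w : E ≃ₗ[ℝ] E} (hw : w ∈ weyl b) {q : E}
    (hq : q ∈ corootLattice b) : affMk w q ∈ affineWeyl b := by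
  have := mul_mem (translation_mem b hq) (weyl_affMk_mem b hw)
  rwa [affMk_mul, one_mul, map_zero, zero_add] at this

end AffineGroup

/-! ### The translates of the fundamental domain tile the space. -/

section Tiling

variable {ι E N : Type*} [Finite ι] [NormedAddCommGroup E] [InnerProductSpace ℝ E]
  [FiniteDimensional ℝ E] [AddCommGroup N] [Module ℝ N] {P : RootPairing ι ℝ E N}
  [P.IsRootSystem] [P.IsCrystallographic] [P.IsReduced] [IsEuclidean P]

omit [P.IsCrystallographic] [P.IsReduced] [FiniteDimensional ℝ E] [IsEuclidean P] in
lemma isClosed_corootLattice (b : P.Base) : IsClosed (corootLattice b : Set E) := by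
  have : DiscreteTopology (corootLattice b).toAddSubgroup :=
    inferInstanceAs (DiscreteTopology (Submodule.span ℤ (range (corootBasis b))))
  exact AddSubgroup.isClosed_of_discrete (H := (corootLattice b).toAddSubgroup)

/-- Every point can be moved into the closed fundamental domain: minimize the distance to an
interior point over the orbit. -/
lemma exists_affineWeyl_nonneg (b : P.Base) (x : E) :
    ∃ g ∈ affineWeyl b, ∀ a ∈ simpleAff b, 0 ≤ affVal P a (g x) := by
  obtain ⟨y, hy⟩ := fundDomain_nonempty b
  -- The orbit of `x`, written as a finite union of translates of the closed lattice; it is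
  -- therefore closed and the distance to `y` is attained.
  let S : Set E := ⋃ w : weyl b, (fun q => (w : E ≃ₗ[ℝ] E) x + q) '' (corootLattice b : Set E)
  have hS : IsClosed S := isClosed_iUnion_of_finite fun w =>
    (Homeomorph.addLeft ((w : E ≃ₗ[ℝ] E) x)).isClosedMap _ (isClosed_corootLattice b)
  have hmem : ∀ g ∈ affineWeyl b, g x ∈ S := by
    intro g hg
    obtain ⟨w, hw, q, hq, rfl⟩ := affineWeyl_eq_affMk hg
    exact mem_iUnion.mpr ⟨⟨w, hw⟩, q, hq, (affMk_apply w q x).symm⟩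
  obtain ⟨z, hz, hmin⟩ := hS.exists_infDist_eq_dist ⟨x, hmem 1 (one_mem _)⟩ y
  obtain ⟨w, q, hq, rfl⟩ := mem_iUnion.mp hz
  refine ⟨_, affMk_mem b w.2 hq, fun a ha => ?_⟩
  -- Reflecting the nearest point in a wall stays in the orbit and cannot come closer to `y`, so the
  -- two points are not separated by that wall.
  have hg : affRefl P a * affMk w q ∈ affineWeyl b := by
    refine mul_mem ?_ (affMk_mem b w.2 hq)
    rw [affineWeyl_eq_closure]
    exact Subgroup.subset_closure ⟨a, ha, rfl⟩
  have h1 := Metric.infDist_le_dist_of_mem (x := y) (hmem _ hg)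
  simp only [hmin, ← affMk_apply, dist_eq_norm] at h1
  have h2 : ‖y - affMk w q x‖ ^ 2 ≤ ‖y - affRefl P a (affMk w q x)‖ ^ 2 :=
    pow_le_pow_left₀ (norm_nonneg _) h1 2
  rw [norm_sub_affRefl_sq] at h2
  have h3 : 0 ≤ 4 / ⟪P.root a.1, P.root a.1⟫_ℝ * (affVal P a (affMk w q x) * affVal P a y) := by
    linarith
  have hpos := inner_root_self_pos (P := P) a.1
  rw [mul_nonneg_iff_of_pos_left (by positivity)] at h3
  exact nonneg_of_mul_nonneg_left h3 (mem_fundDomain_iff.mp hy a ha)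

omit [Finite ι] [P.IsReduced] [FiniteDimensional ℝ E] in
/-- The affine Weyl group permutes the affine roots. -/
lemma exists_affVal_comp {b : P.Base} {w : E ≃ₗ[ℝ] E} (hw : w ∈ weyl b) {q : E}
    (hq : q ∈ corootLattice b) (a : ι × ℤ) :
    ∃ a' : ι × ℤ, (∀ x, affVal P a (affMk w q x) = affVal P a' x) ∧
      affRefl P a * affMk w q = affMk w q * affRefl P a' := by
  obtain ⟨j, hj⟩ := weyl_root (inv_mem hw) a.1
  obtain ⟨n, hn⟩ := inner_root_corootLattice_int b a.1 hq
  have hval : ∀ x, affVal P a (affMk w q x) = affVal P (j, a.2 + n) x := fun x => by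
    simp only [affVal, affMk_apply, inner_add_left]
    rw [weyl_inner_left hw, hj, real_inner_comm, real_inner_comm _ q, hn, real_inner_comm]
    push_cast; ring
  refine ⟨(j, a.2 + n), hval, ?_⟩
  have hc : w (corootVec P j) = corootVec P a.1 := by
    rw [← reflection_ofRoot (weyl_inner (inv_mem hw)) hj, ← LinearEquiv.mul_apply, mul_inv_cancel]
    rfl
  ext x
  change affRefl P a (affMk w q x) = affMk w q (affRefl P (j, a.2 + n) x)
  rw [affRefl_apply, affRefl_apply, hval, affMk_apply, affMk_apply, map_sub, map_smul, hc]
  abel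

/-- The only affine root that is positive on the fundamental domain and whose sign there is changed
by a simple affine reflection is the corresponding simple affine root. -/
lemma eq_of_affVal_affRefl_neg {b : P.Base} {s a : ι × ℤ} (hs : s ∈ simpleAff b)
    (ha : ∀ x ∈ fundDomain b, 0 < affVal P a x) {y : E} (hy : y ∈ fundDomain b)
    (hn : affVal P a (affRefl P s y) < 0) : a = s := by
  -- The affine root `a` vanishes on the facet of `s`: there it is nonnegative as a limit from `F`,
  -- and nonpositive because `a ∘ r_s` is negative on all of `F` while `r_s` fixes the facet.
  have hzero : ∀ p, affVal P s p = 0 → (∀ t ∈ simpleAff b, 0 ≤ affVal P t p) →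
      affVal P a p = 0 := by
    intro p h0 hp
    have hcl := mem_closure_fundDomain hp
    refine le_antisymm ?_ ?_
    · obtain ⟨a', ha', -⟩ := exists_affVal_comp (reflection_mem_weyl b s.1)
        (neg_mem (Submodule.smul_mem _ s.2 (corootVec_mem_corootLattice b s.1))) a
      rw [← Int.cast_smul_eq_zsmul ℝ, ← affRefl_eq_affMk] at ha'
      have hneg := (affVal_pos_or_neg b a').resolve_left fun h => by
        have := h y hy
        rw [← ha'] at this
        linarith
      have : affRefl P s p = p := by rw [affRefl_apply, h0, zero_smul, sub_zero]
      rw [← this, ha']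
      have hle : fundDomain b ⊆ {x | affVal P a' x ≤ 0} := fun x hx => (hneg x hx).le
      exact closure_minimal hle (isClosed_le (continuous_affVal a') continuous_const) hcl
    · have hle : fundDomain b ⊆ {x | 0 ≤ affVal P a x} := fun x hx => (ha x hx).le
      exact closure_minimal hle (isClosed_le continuous_const (continuous_affVal a)) hcl
  obtain ⟨j, k⟩ := a
  obtain ⟨j', hj'⟩ := exists_root_neg (P := P) j
  have hy0 := ha y hy
  simp only [affVal] at hy0
  rcases hs with ⟨hi, h2⟩ | ⟨ξ, hξ, hsξ, h2⟩
  · obtain ⟨p, hp0, hp1, hp2⟩ := exists_facet_point_of_mem_support (b := b) s.1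
    have hpn : ∀ i ∈ b.support, 0 ≤ ⟪p, P.root i⟫_ℝ := fun i hi' => by
      rcases eq_or_ne i s.1 with rfl | hne
      exacts [(hp0 hi').ge, (hp1 i hi' hne).le]
    have h := hzero p (by simp [affVal, hp0 hi, h2]) (by
      rintro t (⟨ht, ht2⟩ | ⟨η, -, ht, ht2⟩)
      · simpa [affVal, ht2] using hpn _ ht
      · have := hp2 η
        simp only [affVal, ht, ht2, inner_neg_right]
        push_cast
        linarith)
    simp only [affVal] at h
    have hneg : ⟪p, P.root j'⟫_ℝ = -⟪p, P.root j⟫_ℝ := by rw [hj', inner_neg_right]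
    -- At `p` every root has value of modulus less than 1, with the sign of the root, so an integer
    -- value is 0.
    have hk : k = 0 := by
      rcases b.root_mem_or_neg_mem j with hj | hj
      · have h3 := inner_posCone_nonneg hpn hj
        have h4 := hp2 j
        have h5 : (k : ℝ) ≤ 0 := by linarith
        have h6 : (-1 : ℝ) < k := by linarith
        have h5' : k ≤ 0 := by exact_mod_cast h5
        have h6' : -1 < k := by exact_mod_cast h6
        omega
      · rw [← hj'] at hj
        have h3 := inner_posCone_nonneg hpn hj
        have h4 := hp2 j'
        have h5 : (0 : ℝ) ≤ k := by linarith
        have h6 : (k : ℝ) < 1 := by linarith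
        have h5' : 0 ≤ k := by exact_mod_cast h5
        have h6' : k < 1 := by exact_mod_cast h6
        omega
    subst hk
    have hj : P.root j ∈ posCone b := by
      refine (b.root_mem_or_neg_mem j).resolve_right fun hj => ?_
      have := inner_posCone_nonneg (fun i hi => (hy.1 i hi).le) hj
      rw [inner_neg_right] at this
      push_cast at hy0
      linarith
    push_cast at h
    obtain ⟨n, hn'⟩ := posCone_eq_nsmul (hp0 hi) hp1 hj (by linarith)
    -- A positive root vanishing at `p` is a multiple of the simple root; reducedness leaves only
    -- plus or minus it.
    have hred := RootPairing.IsReduced.eq_or_eq_neg (P := P) j s.1 (by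
      rw [LinearIndependent.pair_iff]
      intro hli
      have := (hli 1 (-(n : ℝ)) (by rw [hn', ← Nat.cast_smul_eq_nsmul ℝ]; simp)).1
      exact one_ne_zero this)
    have hjs : P.root j = P.root s.1 := by
      refine hred.resolve_right fun h' => ?_
      have h1 := hy.1 _ hi
      rw [h', inner_neg_right] at hy0
      push_cast at hy0
      linarith
    exact Prod.ext (P.root.injective hjs) h2.symm
  · obtain ⟨p, hp0, hp1, hp2⟩ := exists_facet_point_of_isHighestRoot hξ
    have hp2' : ∀ η, IsHighestRoot b η → ⟪p, P.root η⟫_ℝ ≤ 1 := fun η hη => by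
      rcases eq_or_ne η ξ with rfl | hne
      exacts [hp0.le, (hp2 η hη hne).le]
    have h := hzero p (by simp [affVal, hsξ, hp0, h2]) (by
      rintro t (⟨ht, ht2⟩ | ⟨η, hη, ht, ht2⟩)
      · simpa [affVal, ht2] using (hp1 _ ht).le
      · have := hp2' η hη
        simp only [affVal, ht, ht2, inner_neg_right]
        push_cast
        linarith)
    -- At this facet point positive roots take values in `(0, 1]`, with 1 attained only by `ξ`; thus
    -- an integral value singles out `ξ`.
    have key : ∀ i, P.root i ∈ posCone b → ∀ m : ℤ, ⟪p, P.root i⟫_ℝ = m → m = 1 ∧ i = ξ := by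
      intro i hi m hm
      obtain ⟨η, hη, hle⟩ := exists_isHighestRoot b i
      have h3 := inner_posCone_pos hp1 hi (P.ne_zero i)
      have h4 := inner_posCone_nonneg (fun i hi => (hp1 i hi).le) hle
      rw [inner_sub_right] at h4
      have h5 := hp2' η hη
      have hm1 : m = 1 := by
        have h6 : (0 : ℝ) < m := by linarith
        have h7 : (m : ℝ) ≤ 1 := by linarith
        have h6' : 0 < m := by exact_mod_cast h6
        have h7' : m ≤ 1 := by exact_mod_cast h7
        omega
      refine ⟨hm1, ?_⟩
      rw [hm1] at hm
      push_cast at hm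
      have hηξ : η = ξ := by
        by_contra hne
        linarith [hp2 η hη hne]
      subst hηξ
      by_contra hne
      have := inner_posCone_pos hp1 hle (sub_ne_zero.mpr fun h => hne (P.root.injective h.symm))
      rw [inner_sub_right] at this
      linarith
    simp only [affVal] at h
    rcases b.root_mem_or_neg_mem j with hj | hj
    · obtain ⟨hk, rfl⟩ := key j hj (-k) (by push_cast; linarith)
      have hk' : k = -1 := by omega
      have := hy.2 j hξ
      rw [hk'] at hy0
      push_cast at hy0
      linarith
    · rw [← hj'] at hj
      have hneg : ⟪p, P.root j'⟫_ℝ = -⟪p, P.root j⟫_ℝ := by rw [hj', inner_neg_right]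
      obtain ⟨hk, rfl⟩ := key j' hj k (by linarith)
      refine Prod.ext (P.root.injective ?_) (by rw [h2]; exact hk)
      rw [hsξ, hj', neg_neg]

omit [Finite ι] [FiniteDimensional ℝ E] [P.IsRootSystem] [P.IsCrystallographic]
  [P.IsReduced] in
lemma affRefl_mem {b : P.Base} {s : ι × ℤ} (hs : s ∈ simpleAff b) : affRefl P s ∈ affineWeyl b := by
  rw [affineWeyl_eq_closure]
  exact Subgroup.subset_closure ⟨s, hs, rfl⟩

omit [Finite ι] [FiniteDimensional ℝ E] [P.IsRootSystem] [P.IsCrystallographic]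
  [P.IsReduced] in
lemma prod_affRefl_mem {b : P.Base} {l : List (ι × ℤ)} (hl : ∀ s ∈ l, s ∈ simpleAff b) :
    (l.map (affRefl P)).prod ∈ affineWeyl b := by
  refine list_prod_mem fun g hg => ?_
  obtain ⟨s, hs, rfl⟩ := List.mem_map.mp hg
  exact affRefl_mem (hl s hs)

/-- The deletion property. -/
lemma exists_shorter_word {b : P.Base} {y : E} (hy : y ∈ fundDomain b) {s : ι × ℤ}
    (hs : s ∈ simpleAff b) (l : List (ι × ℤ)) (hl : ∀ t ∈ l, t ∈ simpleAff b)
    (hneg : affVal P s ((l.map (affRefl P)).prod y) < 0) :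
    ∃ l' : List (ι × ℤ), (∀ t ∈ l', t ∈ simpleAff b) ∧ l'.length < l.length ∧
      (l.map (affRefl P)).prod = affRefl P s * (l'.map (affRefl P)).prod := by
  induction l using List.reverseRecOn with
  | nil =>
    have := mem_fundDomain_iff.mp hy s hs
    simp only [List.map_nil, List.prod_nil] at hneg
    exact absurd hneg this.not_gt
  | append_singleton l t ih =>
    have hl0 : ∀ u ∈ l, u ∈ simpleAff b := fun u hu => hl u (List.mem_append_left _ hu)
    have ht : t ∈ simpleAff b := hl t (by simp)
    obtain ⟨w, hw, q, hq, hg⟩ := affineWeyl_eq_affMk (prod_affRefl_mem hl0)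
    obtain ⟨a, ha, hconj⟩ := exists_affVal_comp hw hq s
    rw [← hg] at ha hconj
    -- Here `a` is `s` pulled back through the word without its last letter `t`. If `a` is positive
    -- on `F`, then `a = t` and conjugation turns the final `r_t` into an initial `r_s`. Otherwise
    -- the shorter word already makes `s` negative.
    rcases affVal_pos_or_neg b a with hpos | hn
    · have hat : a = t := by
        refine eq_of_affVal_affRefl_neg ht hpos hy ?_
        rw [← ha]
        simpa using hneg
      subst hat
      exact ⟨l, hl0, by simp, by simp [hconj]⟩
    · obtain ⟨l', h1, h2, h3⟩ := ih hl0 (by rw [ha]; exact hn y hy)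
      refine ⟨l' ++ [t], ?_, by simpa using h2, ?_⟩
      · intro u hu
        rcases List.mem_append.mp hu with h | h
        · exact h1 u h
        · rw [List.mem_singleton.mp h]; exact ht
      · simp only [List.map_append, List.prod_append, h3, mul_assoc]

/-- If `s` is the first letter, the tail sends `y` to the negative side of `s`. By deletion the tail
equals `r_s` times a shorter word, and the two copies of `r_s` cancel. -/
lemma prod_affRefl_eq_one {b : P.Base} {y : E} (hy : y ∈ fundDomain b) (n : ℕ) :
    ∀ l : List (ι × ℤ), l.length = n → (∀ t ∈ l, t ∈ simpleAff b) →
      (l.map (affRefl P)).prod y ∈ fundDomain b → (l.map (affRefl P)).prod = 1 := by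
  induction n using Nat.strong_induction_on with
  | _ n ih =>
    intro l hn hl hmem
    cases l with
    | nil => rfl
    | cons s l =>
      have hs : s ∈ simpleAff b := hl s (by simp)
      have hl0 : ∀ u ∈ l, u ∈ simpleAff b := fun u hu => hl u (List.mem_cons_of_mem _ hu)
      have h1 := mem_fundDomain_iff.mp hmem s hs
      rw [List.map_cons, List.prod_cons] at h1 hmem ⊢
      change 0 < affVal P s (affRefl P s ((l.map (affRefl P)).prod y)) at h1
      rw [affVal_affRefl_self] at h1
      obtain ⟨l', h2, h3, h4⟩ := exists_shorter_word hy hs l hl0 (by linarith)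
      rw [h4, ← mul_assoc, affRefl_mul_self, one_mul] at hmem ⊢
      exact ih _ (by rw [← hn]; simp only [List.length_cons]; omega) l' rfl h2 hmem

/-- The affine Weyl group acts freely on the translates of the fundamental domain. -/
lemma affineWeyl_eq_one {b : P.Base} {g : E ≃ᵃ[ℝ] E} (hg : g ∈ affineWeyl b) {y : E}
    (hy : y ∈ fundDomain b) (hgy : g y ∈ fundDomain b) : g = 1 := by
  have : ∃ l : List (ι × ℤ), (∀ t ∈ l, t ∈ simpleAff b) ∧ g = (l.map (affRefl P)).prod := by
    clear hgy
    rw [affineWeyl_eq_closure, ← Subgroup.mem_toSubmonoid, Subgroup.closure_toSubmonoid] at hg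
    obtain ⟨L, hL, rfl⟩ := Submonoid.exists_list_of_mem_closure hg
    clear hg
    induction L with
    | nil => exact ⟨[], by simp, by simp⟩
    | cons u L ih =>
      obtain ⟨l, h1, h2⟩ := ih fun x hx => hL x (List.mem_cons_of_mem _ hx)
      have : ∃ s ∈ simpleAff b, u = affRefl P s := by
        rcases hL u (by simp) with ⟨s, hs, h⟩ | ⟨s, hs, h⟩
        · exact ⟨s, hs, h.symm⟩
        · refine ⟨s, hs, ?_⟩
          rw [← inv_inv u, ← h, inv_eq_iff_mul_eq_one, affRefl_mul_self]
      obtain ⟨s, hs, rfl⟩ := this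
      refine ⟨s :: l, ?_, by simp [h2]⟩
      intro t ht
      rcases List.mem_cons.mp ht with rfl | h
      exacts [hs, h1 t h]
  obtain ⟨l, hl, rfl⟩ := this
  exact prod_affRefl_eq_one hy _ l rfl hl hgy

lemma weyl_eq_one_and_eq_zero {b : P.Base} {w : E ≃ₗ[ℝ] E} (hw : w ∈ weyl b) {q : E}
    (hq : q ∈ corootLattice b) {y : E} (hy : y ∈ fundDomain b) (hgy : w y + q ∈ fundDomain b) :
    w = 1 ∧ q = 0 := by
  have h := affineWeyl_eq_one (affMk_mem b hw hq) hy (by rwa [affMk_apply])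
  have hq0 : q = 0 := by
    have := congrArg (fun g : E ≃ᵃ[ℝ] E => g 0) h
    simpa [affMk_apply] using this
  refine ⟨?_, hq0⟩
  ext x
  have := congrArg (fun g : E ≃ᵃ[ℝ] E => g x) h
  simpa [affMk_apply, hq0] using this

end Tiling

/-! ### Weights, characters and symmetries of the orbit functions. -/

section Weights

variable {ι E N : Type*} [NormedAddCommGroup E] [InnerProductSpace ℝ E]
  [AddCommGroup N] [Module ℝ N] {P : RootPairing ι ℝ E N}

/-- The weight lattice. -/
def weights (b : P.Base) : Set E := {μ | ∀ i ∈ b.support, ∃ m : ℤ, ⟪μ, corootVec P i⟫_ℝ = m}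

lemma strictWeights_subset_weights (b : P.Base) : strictWeights b ⊆ weights b := by
  intro μ hμ i hi
  obtain ⟨m, -, h⟩ := hμ i hi
  exact ⟨m, by rw [h]; simp⟩

lemma strictWeights_inner_pos {b : P.Base} {μ : E} (hμ : μ ∈ strictWeights b) {i : ι}
    (hi : i ∈ b.support) : 0 < ⟪μ, P.root i⟫_ℝ := by
  obtain ⟨m, hm, h⟩ := hμ i hi
  rw [← inner_corootVec_pos_iff, h]
  exact_mod_cast hm

/-- The character `x ↦ exp (2πi ⟨μ, x⟩)`. -/
def character (μ x : E) : ℂ := Complex.exp (2 * Real.pi * Complex.I * (⟪μ, x⟫_ℝ : ℂ))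

@[fun_prop]
lemma continuous_character (μ : E) : Continuous (character μ) := by
  unfold character; fun_prop

lemma character_add_right (μ x y : E) : character μ (x + y) = character μ x * character μ y := by
  simp only [character, inner_add_right]
  rw [← Complex.exp_add]
  push_cast
  ring_nf

lemma character_add_left (μ κ x : E) : character (μ + κ) x = character μ x * character κ x := by
  simp only [character, inner_add_left]
  rw [← Complex.exp_add]
  push_cast
  ring_nf

lemma character_zero (x : E) : character 0 x = 1 := by simp [character]

lemma conj_character (μ x : E) : conj (character μ x) = character (-μ) x := by
  simp only [character, inner_neg_left, ← Complex.exp_conj, map_mul, Complex.conj_I,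
    Complex.conj_ofReal, map_ofNat]
  push_cast
  ring_nf

lemma norm_character (μ x : E) : ‖character μ x‖ = 1 := by
  rw [character, Complex.norm_exp]
  simp

lemma character_add_lattice [P.IsRootSystem] {b : P.Base} {μ : E} (hμ : μ ∈ weights b) {q : E}
    (hq : q ∈ corootLattice b) (x : E) : character μ (x + q) = character μ x := by
  obtain ⟨n, hn⟩ := inner_corootLattice_int hμ hq
  rw [character_add_right]
  have : character μ q = 1 := by
    rw [character, hn, Complex.exp_eq_one_iff]
    exact ⟨n, by push_cast; ring⟩
  rw [this, mul_one]

/-- The determinant of a linear automorphism, as a complex number. -/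
def detC (w : E ≃ₗ[ℝ] E) : ℂ := ((LinearMap.det (w : E →ₗ[ℝ] E) : ℝ) : ℂ)

lemma detC_mul (v w : E ≃ₗ[ℝ] E) : detC (v * w) = detC v * detC w := by
  have : ((v * w : E ≃ₗ[ℝ] E) : E →ₗ[ℝ] E) = (v : E →ₗ[ℝ] E) * (w : E →ₗ[ℝ] E) := rfl
  simp only [detC, this, map_mul]
  push_cast; rfl

lemma detC_one : detC (1 : E ≃ₗ[ℝ] E) = 1 := by
  simp [detC]

lemma detC_mul_self [FiniteDimensional ℝ E] {b : P.Base} {w : E ≃ₗ[ℝ] E} (hw : w ∈ weyl b) :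
    detC w * detC w = 1 := by
  rcases weyl_det hw with h | h <;> simp [detC, h]

lemma norm_detC [FiniteDimensional ℝ E] {b : P.Base} {w : E ≃ₗ[ℝ] E} (hw : w ∈ weyl b) :
    ‖detC w‖ = 1 := by
  rcases weyl_det hw with h | h <;> simp [detC, h]

lemma conj_detC (w : E ≃ₗ[ℝ] E) : conj (detC w) = detC w := by simp [detC]

lemma detC_inv [FiniteDimensional ℝ E] {b : P.Base} {w : E ≃ₗ[ℝ] E} (hw : w ∈ weyl b) :
    detC w⁻¹ = detC w := by
  have h1 := detC_mul_self hw
  have h2 : detC w⁻¹ * detC w = 1 := by rw [← detC_mul, inv_mul_cancel, detC_one]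
  calc detC w⁻¹ = detC w⁻¹ * (detC w * detC w) := by rw [h1, mul_one]
    _ = detC w := by rw [← mul_assoc, h2, one_mul]

instance weyl_fintype [Finite ι] [P.IsRootSystem] (b : P.Base) : Fintype (weyl b) :=
  Fintype.ofFinite _

variable [Finite ι] [P.IsRootSystem]

lemma orbitFun_eq_sum (b : P.Base) (μ x : E) :
    orbitFun b μ x = ∑ w : weyl b, detC (w : E ≃ₗ[ℝ] E) * character ((w : E ≃ₗ[ℝ] E) μ) x :=
  finsum_eq_sum_of_fintype _

@[fun_prop]
lemma continuous_orbitFun (b : P.Base) (μ : E) : Continuous (orbitFun b μ) := by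
  simp only [funext (orbitFun_eq_sum b μ)]
  fun_prop

variable [FiniteDimensional ℝ E]

lemma norm_orbitFun_le (b : P.Base) (μ x : E) : ‖orbitFun b μ x‖ ≤ Nat.card (weyl b) := by
  rw [orbitFun_eq_sum]
  refine (norm_sum_le _ _).trans ?_
  simp_rw [norm_mul, norm_character, mul_one]
  rw [Finset.sum_congr rfl fun w _ => norm_detC w.2]
  simp

lemma orbitFun_weyl_left {b : P.Base} {v : E ≃ₗ[ℝ] E} (hv : v ∈ weyl b) (μ x : E) :
    orbitFun b (v μ) x = detC v * orbitFun b μ x := by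
  rw [orbitFun_eq_sum, orbitFun_eq_sum, Finset.mul_sum]
  refine Fintype.sum_equiv (Equiv.mulRight (⟨v, hv⟩ : weyl b)) _ _ fun w => ?_
  simp only [Equiv.coe_mulRight, Subgroup.coe_mul, detC_mul, LinearEquiv.mul_apply]
  linear_combination (-(detC (w : E ≃ₗ[ℝ] E) * character ((w : E ≃ₗ[ℝ] E) (v μ)) x)) *
    detC_mul_self hv

/-- Antisymmetry under `r_i` gives `φ_μ = -φ_μ`. -/
lemma orbitFun_eq_zero {b : P.Base} {i : ι} (hi : i ∈ b.support) {μ : E}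
    (hμ : P.reflection i μ = μ) (x : E) : orbitFun b μ x = 0 := by
  have h := orbitFun_weyl_left (b := b) (Subgroup.subset_closure ⟨i, hi, rfl⟩) μ x
  rw [hμ, detC, det_reflection] at h
  push_cast at h
  linear_combination h / 2

variable [IsEuclidean P]

omit [Finite ι] [P.IsRootSystem] [FiniteDimensional ℝ E] in
lemma character_weyl {b : P.Base} {w : E ≃ₗ[ℝ] E} (hw : w ∈ weyl b) (μ x : E) :
    character μ (w x) = character (w⁻¹ μ) x := by
  rw [character, character, weyl_inner_left (inv_mem hw), inv_inv]

omit [FiniteDimensional ℝ E] in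
lemma orbitFun_weyl_right {b : P.Base} {v : E ≃ₗ[ℝ] E} (hv : v ∈ weyl b) (μ x : E) :
    orbitFun b μ (v x) = detC v * orbitFun b μ x := by
  rw [orbitFun_eq_sum, orbitFun_eq_sum, Finset.mul_sum]
  refine (Fintype.sum_equiv (Equiv.mulLeft (⟨v, hv⟩ : weyl b)) _ _ fun w => ?_).symm
  simp only [Equiv.coe_mulLeft, Subgroup.coe_mul, detC_mul, character_weyl hv]
  rw [← LinearEquiv.mul_apply, inv_mul_cancel_left, mul_assoc]

omit [Finite ι] [FiniteDimensional ℝ E] in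
lemma weyl_mem_weights {b : P.Base} {w : E ≃ₗ[ℝ] E} (hw : w ∈ weyl b) {μ : E}
    (hμ : μ ∈ weights b) : w μ ∈ weights b := by
  intro i _
  rw [weyl_inner_left hw]
  exact inner_corootLattice_int hμ
    (weyl_mem_corootLattice (inv_mem hw) (corootVec_mem_corootLattice b i))

omit [FiniteDimensional ℝ E] in
lemma orbitFun_add_lattice {b : P.Base} {μ : E} (hμ : μ ∈ weights b) {q : E}
    (hq : q ∈ corootLattice b) (x : E) : orbitFun b μ (x + q) = orbitFun b μ x := by
  rw [orbitFun_eq_sum, orbitFun_eq_sum]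
  exact Finset.sum_congr rfl fun w _ => by rw [character_add_lattice (weyl_mem_weights w.2 hμ) hq]

/-- A weight is conjugate to a strictly dominant weight or to a weight fixed by a simple
reflection. -/
lemma weights_dichotomy {b : P.Base} {μ : E} (hμ : μ ∈ weights b) :
    ∃ w ∈ weyl b, w μ ∈ strictWeights b ∨ ∃ i ∈ b.support, P.reflection i (w μ) = w μ := by
  obtain ⟨w, hw, h⟩ := exists_weyl_dominant b μ
  refine ⟨w, hw, ?_⟩
  by_contra! hcon
  obtain ⟨h1, h2⟩ := hcon
  refine h1 fun i hi => ?_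
  obtain ⟨m, hm⟩ := weyl_mem_weights hw hμ i hi
  have h3 : (0 : ℝ) ≤ m := by
    rw [← hm]; exact (inner_corootVec_nonneg_iff i _).mpr (h i hi)
  have h3' : 0 ≤ m := by exact_mod_cast h3
  have h4 : m ≠ 0 := by
    rintro rfl
    refine h2 i hi ?_
    rw [reflection_apply_eq, hm]
    simp
  refine ⟨m.toNat, by omega, ?_⟩
  rw [hm, ← Int.cast_natCast, Int.toNat_of_nonneg h3']

/-- Every `φ_μ` is up to sign one with strictly dominant weight, or zero. Antisymmetrized
trigonometric polynomials therefore need only strictly dominant weights. -/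
lemma orbitFun_mem_span {b : P.Base} {μ : E} (hμ : μ ∈ weights b) :
    orbitFun b μ ∈ Submodule.span ℂ (range fun κ : strictWeights b => orbitFun b (κ : E)) := by
  obtain ⟨w, hw, h⟩ := weights_dichotomy hμ
  have hμw : orbitFun b μ = detC w • orbitFun b (w μ) := by
    ext x
    rw [Pi.smul_apply, orbitFun_weyl_left hw, smul_eq_mul, ← mul_assoc, detC_mul_self hw, one_mul]
  rw [hμw]
  refine Submodule.smul_mem _ _ ?_
  rcases h with h | ⟨i, hi, h⟩
  · exact Submodule.subset_span ⟨⟨_, h⟩, rfl⟩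
  · have : orbitFun b (w μ) = 0 := funext fun x => orbitFun_eq_zero hi h x
    rw [this]
    exact zero_mem _

variable [P.IsCrystallographic] [P.IsReduced]

/-- Shrinking `x` and `w x` by a common factor puts both in `F`, where the affine group acts freely.
-/
lemma weyl_eq_one_of_pos {b : P.Base} {w : E ≃ₗ[ℝ] E} (hw : w ∈ weyl b) {x : E}
    (hx : ∀ i ∈ b.support, 0 < ⟪x, P.root i⟫_ℝ) (hwx : ∀ i ∈ b.support, 0 < ⟪w x, P.root i⟫_ℝ) :
    w = 1 := by
  obtain ⟨t, ht, h⟩ := exists_smul_inner_root_lt_one P x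
  obtain ⟨u, hu, h'⟩ := exists_smul_inner_root_lt_one P (w x)
  have hpos : 0 < min t u := lt_min ht hu
  have hscale : ∀ {y : E} {s r : ℝ}, 0 < r → r ≤ s →
      (∀ i ∈ b.support, 0 < ⟪y, P.root i⟫_ℝ) → (∀ k, ⟪s • y, P.root k⟫_ℝ < 1) →
      r • y ∈ fundDomain b := by
    intro y s r hr hrs hy hs
    refine ⟨fun i hi => ?_, fun ξ hξ => ?_⟩
    · rw [real_inner_smul_left]
      exact mul_pos hr (hy i hi)
    · have h1 := hs ξ
      rw [real_inner_smul_left] at h1 ⊢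
      have := inner_posCone_pos hy hξ.root_mem (P.ne_zero ξ)
      nlinarith
  refine (weyl_eq_one_and_eq_zero (b := b) hw (zero_mem _)
    (hscale hpos (min_le_left t u) hx h) ?_).1
  rw [map_smul, add_zero]
  exact hscale hpos (min_le_right t u) hwx h'

lemma weyl_eq_of_strictWeights {b : P.Base} {v w : E ≃ₗ[ℝ] E} (hv : v ∈ weyl b) (hw : w ∈ weyl b)
    {κ μ : E} (hκ : κ ∈ strictWeights b) (hμ : μ ∈ strictWeights b) (h : v κ = w μ) :
    v = w ∧ κ = μ := by
  have h1 : (w⁻¹ * v) κ = μ := by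
    rw [LinearEquiv.mul_apply, h, ← LinearEquiv.mul_apply, inv_mul_cancel]; rfl
  have h2 := weyl_eq_one_of_pos (mul_mem (inv_mem hw) hv)
    (fun i hi => strictWeights_inner_pos hκ hi)
    (fun i hi => by rw [h1]; exact strictWeights_inner_pos hμ hi)
  rw [h2] at h1
  exact ⟨(inv_mul_eq_one.mp h2).symm, h1⟩

end Weights

/-! ### Volumes and the unfolding of integrals over the torus. -/

section Measure

open scoped Pointwise

variable {ι E N : Type*} [Finite ι] [NormedAddCommGroup E] [InnerProductSpace ℝ E]
  [FiniteDimensional ℝ E] [MeasurableSpace E] [BorelSpace E]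
  [AddCommGroup N] [Module ℝ N] {P : RootPairing ι ℝ E N} [P.IsRootSystem]

/-- The half-open parallelepiped spanned by the simple coroots. -/
def cell (b : P.Base) : Set E := ZSpan.fundamentalDomain (corootBasis b)

omit [Finite ι] in
lemma volume_parallelepiped_eq (b : P.Base) :
    (volume : Measure E) (parallelepiped fun i : b.support => corootVec P i) =
      volume (cell b) := by
  have : (fun i : b.support => corootVec P i) = corootBasis b := by ext i; simp
  rw [this]
  exact (measure_congr (ZSpan.fundamentalDomain_ae_parallelepiped (corootBasis b) volume)).symm

lemma volume_cell_ne_zero (b : P.Base) : (volume : Measure E) (cell b) ≠ 0 :=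
  ZSpan.measure_fundamentalDomain_ne_zero _

lemma volume_cell_ne_top (b : P.Base) : (volume : Measure E) (cell b) ≠ ⊤ :=
  (ZSpan.fundamentalDomain_isBounded (corootBasis b)).measure_lt_top.ne

omit [Finite ι] in
lemma normMeasure_eq (b : P.Base) :
    normMeasure b = (volume (cell b))⁻¹ • (volume : Measure E) := by
  rw [normMeasure, volume_parallelepiped_eq]

lemma normMeasure_cell (b : P.Base) : normMeasure b (cell b) = 1 := by
  rw [normMeasure_eq, Measure.smul_apply, smul_eq_mul]
  exact ENNReal.inv_mul_cancel (volume_cell_ne_zero b) (volume_cell_ne_top b)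

instance normMeasure_isAddHaar (b : P.Base) : (normMeasure b).IsAddHaarMeasure := by
  rw [normMeasure_eq]
  exact Measure.IsAddHaarMeasure.smul _ (ENNReal.inv_ne_zero.mpr (volume_cell_ne_top b))
    (ENNReal.inv_ne_top.mpr (volume_cell_ne_zero b))

instance countable_corootLattice (b : P.Base) : Countable (corootLattice b) :=
  inferInstanceAs (Countable (Submodule.span ℤ (range (corootBasis b))))

instance vaddInvariant_corootLattice (b : P.Base) (ν : Measure E) [ν.IsAddHaarMeasure] :
    VAddInvariantMeasure (corootLattice b) E ν :=
  inferInstanceAs (VAddInvariantMeasure (corootLattice b).toAddSubgroup E ν)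

lemma cell_isAddFundamentalDomain (b : P.Base) :
    IsAddFundamentalDomain (corootLattice b) (cell b) (normMeasure b) :=
  ZSpan.isAddFundamentalDomain (corootBasis b) _

/-- A translate of the cell is again a fundamental domain of the lattice, and a periodic function
has the same integral over both. -/
lemma setIntegral_cell_add {b : P.Base} {k : E → ℂ}
    (hk : ∀ q ∈ corootLattice b, ∀ x, k (x + q) = k x) (y : E) :
    ∫ x in cell b, k (x + y) ∂(normMeasure b) = ∫ x in cell b, k x ∂(normMeasure b) := by
  have h1 : IsAddFundamentalDomain (corootLattice b) (y +ᵥ cell b) (normMeasure b) :=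
    (cell_isAddFundamentalDomain b).vadd_of_comm y
  have h2 : cell b = (fun x => x + y) ⁻¹' (y +ᵥ cell b) := by
    ext x
    simp [Set.mem_vadd_set_iff_neg_vadd_mem, add_comm x y]
  conv_lhs => rw [h2]
  rw [(measurePreserving_add_right (normMeasure b) y).setIntegral_preimage_emb
    (Homeomorph.addRight y).measurableEmbedding k]
  refine h1.setIntegral_eq (cell_isAddFundamentalDomain b) fun q x => ?_
  rw [← hk q q.2 x, add_comm]
  rfl

open Classical in
lemma setIntegral_cell_character {b : P.Base} {μ : E} (hμ : μ ∈ weights b) :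
    ∫ x in cell b, character μ x ∂(normMeasure b) = if μ = 0 then 1 else 0 := by
  split_ifs with h
  · simp [h, character_zero, Measure.real, normMeasure_cell]
  · have h1 := setIntegral_cell_add (b := b) (k := character μ)
      (fun q hq x => character_add_lattice hμ hq x) ((2 * ⟪μ, μ⟫_ℝ)⁻¹ • μ)
    have hpos : ⟪μ, μ⟫_ℝ ≠ 0 := (real_inner_self_pos.mpr h).ne'
    -- Translation by `μ/(2⟨μ, μ⟩)` multiplies the character by `exp(πi) = -1` without changing the
    -- integral, which must vanish.
    have h2 : character μ ((2 * ⟪μ, μ⟫_ℝ)⁻¹ • μ) = -1 := by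
      rw [character, real_inner_smul_right, ← Complex.exp_pi_mul_I]
      congr 1
      have : (2 * ⟪μ, μ⟫_ℝ)⁻¹ * ⟪μ, μ⟫_ℝ = 1 / 2 := by field_simp
      rw [this]
      push_cast
      ring
    simp only [character_add_right, h2, mul_neg, mul_one, integral_neg] at h1
    linear_combination -h1 / 2

/-- The union of the translates of the fundamental domain under the Weyl group. -/
def star (b : P.Base) : Set E := ⋃ w : weyl b, ((w⁻¹ : weyl b) : E ≃ₗ[ℝ] E) ⁻¹' fundDomain b

omit [P.IsRootSystem] in
lemma measurableSet_translate (b : P.Base) (w : weyl b) :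
    MeasurableSet ((w : E ≃ₗ[ℝ] E) ⁻¹' fundDomain b) :=
  ((fundDomain_isOpen b).preimage
    (LinearMap.continuous_of_finiteDimensional ((w : E ≃ₗ[ℝ] E) : E →ₗ[ℝ] E))).measurableSet

lemma measurableSet_star (b : P.Base) : MeasurableSet (star b) :=
  MeasurableSet.iUnion fun w => measurableSet_translate b w⁻¹

omit [Finite ι] [P.IsRootSystem] in
lemma ae_affVal_ne_zero (ν : Measure E) [ν.IsAddHaarMeasure] (a : ι × ℤ) :
    ∀ᵐ x ∂ν, affVal P a x ≠ 0 := by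
  have hroot := inner_root_corootVec_self (P := P) a.1
  rw [real_inner_comm] at hroot
  let p : E := (-(a.2 / 2 : ℝ)) • corootVec P a.1
  have hp : ⟪p, P.root a.1⟫_ℝ = -a.2 := by
    rw [real_inner_smul_left, hroot]; ring
  have hs : {x | affVal P a x = 0} =
      AffineSubspace.mk' p (LinearMap.ker (innerₛₗ ℝ (P.root a.1))) := by
    ext x
    simp only [affVal, mem_ofPred_eq, SetLike.mem_coe, AffineSubspace.mem_mk', vsub_eq_sub,
      LinearMap.mem_ker, innerₛₗ_apply_apply]
    rw [real_inner_comm, inner_sub_right, real_inner_comm p, hp]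
    constructor <;> intro h <;> linarith
  rw [ae_iff]
  simp only [not_not]
  rw [hs]
  refine Measure.addHaar_affineSubspace ν _ fun htop => ?_
  have hmem : p + corootVec P a.1 ∈
      AffineSubspace.mk' p (LinearMap.ker (innerₛₗ ℝ (P.root a.1))) := by
    rw [htop]; exact AffineSubspace.mem_top _ _ _
  simp only [AffineSubspace.mem_mk', vsub_eq_sub, add_sub_cancel_left, LinearMap.mem_ker,
    innerₛₗ_apply_apply, inner_root_corootVec_self] at hmem
  norm_num at hmem

variable [P.IsCrystallographic] [P.IsReduced] [IsEuclidean P]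

omit [MeasurableSpace E] [BorelSpace E] in
lemma exists_affineWeyl_mem_fundDomain (b : P.Base) {x : E} (hx : ∀ a, affVal P a x ≠ 0) :
    ∃ w ∈ weyl b, ∃ q ∈ corootLattice b, w x + q ∈ fundDomain b := by
  obtain ⟨g, hg, h⟩ := exists_affineWeyl_nonneg b x
  obtain ⟨w, hw, q, hq, rfl⟩ := affineWeyl_eq_affMk hg
  refine ⟨w, hw, q, hq, ?_⟩
  rw [← affMk_apply, mem_fundDomain_iff]
  intro a ha
  obtain ⟨a', ha', -⟩ := exists_affVal_comp hw hq a
  refine lt_of_le_of_ne (h a ha) ?_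
  rw [ha']
  exact (hx a').symm

/-- Almost every `x` avoids all affine hyperplanes, so some `w x + q` lies in `F`; then `x + w⁻¹ q`
lies in `w⁻¹ F`. Overlaps are excluded by freeness. -/
lemma star_isAddFundamentalDomain (b : P.Base) :
    IsAddFundamentalDomain (corootLattice b) (star b) (normMeasure b) := by
  refine IsAddFundamentalDomain.mk'' (measurableSet_star b).nullMeasurableSet ?_ ?_
    fun q => (measurePreserving_vadd q (normMeasure b)).quasiMeasurePreserving
  · have : ∀ᵐ x ∂(normMeasure b), ∀ a : ι × ℤ, affVal P a x ≠ 0 :=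
      ae_all_iff.mpr fun a => ae_affVal_ne_zero _ a
    filter_upwards [this] with x hx
    obtain ⟨w, hw, q, hq, h⟩ := exists_affineWeyl_mem_fundDomain b hx
    refine ⟨⟨w⁻¹ q, weyl_mem_corootLattice (inv_mem hw) hq⟩, ?_⟩
    refine mem_iUnion.mpr ⟨⟨w, hw⟩⁻¹, ?_⟩
    rw [inv_inv]
    change w (w⁻¹ q + x) ∈ fundDomain b
    rw [map_add, ← LinearEquiv.mul_apply, mul_inv_cancel, add_comm]
    exact h
  · intro q hq
    refine Disjoint.aedisjoint (Set.disjoint_left.mpr ?_)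
    rintro x ⟨y, hy, rfl⟩ hx
    obtain ⟨v, hv⟩ := mem_iUnion.mp hy
    obtain ⟨w, hw⟩ := mem_iUnion.mp hx
    generalize v⁻¹ = v at hv
    generalize w⁻¹ = w at hw
    have hw' : (w : E ≃ₗ[ℝ] E) ((q : E) + y) ∈ fundDomain b := hw
    have h := weyl_eq_one_and_eq_zero (b := b) (mul_mem w.2 (inv_mem v.2))
      (weyl_mem_corootLattice w.2 q.2) hv (by
        rw [LinearEquiv.mul_apply, ← LinearEquiv.mul_apply _ _ y, inv_mul_cancel, add_comm]
        simpa using hw')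
    exact hq (Subtype.ext (by simpa using h.2))

omit [Finite ι] [P.IsCrystallographic] [P.IsReduced] in
lemma weyl_measurePreserving {b : P.Base} (w : weyl b) :
    MeasurePreserving (w : E ≃ₗ[ℝ] E) (normMeasure b) (normMeasure b) := by
  have h := ((w : E ≃ₗ[ℝ] E).isometryOfInner (weyl_inner w.2)).measurePreserving
  rw [normMeasure_eq]
  exact h.smul_measure _

omit [MeasurableSpace E] [BorelSpace E] in
lemma pairwise_disjoint_translates (b : P.Base) :
    Pairwise (Function.onFun Disjoint
      fun w : weyl b => ((w⁻¹ : weyl b) : E ≃ₗ[ℝ] E) ⁻¹' fundDomain b) := by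
  intro v w hvw
  refine Set.disjoint_left.mpr fun x hv hw => hvw ?_
  have h := weyl_eq_one_and_eq_zero (b := b) (mul_mem (w⁻¹).2 (inv_mem (v⁻¹).2))
    (zero_mem _) hv (by
      rw [LinearEquiv.mul_apply, ← LinearEquiv.mul_apply _ _ x, inv_mul_cancel, add_zero]
      exact hw)
  have h1 : w⁻¹ * (v⁻¹)⁻¹ = 1 := Subtype.ext h.1
  rw [inv_inv, inv_mul_eq_one] at h1
  exact h1.symm

lemma normMeasure_star (b : P.Base) :
    normMeasure b (star b) = Nat.card (weyl b) * normMeasure b (fundDomain b) := by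
  rw [star, measure_iUnion (pairwise_disjoint_translates b)
    (fun w => measurableSet_translate b w⁻¹), tsum_fintype]
  have : ∀ w : weyl b, normMeasure b (((w⁻¹ : weyl b) : E ≃ₗ[ℝ] E) ⁻¹' fundDomain b) =
      normMeasure b (fundDomain b) := fun w =>
    (weyl_measurePreserving w⁻¹).measure_preimage (fundDomain_isOpen b).nullMeasurableSet
  rw [Finset.sum_congr rfl fun w _ => this w]
  simp

/-- The parallelepiped and the union of the `wF` are fundamental domains of the same lattice, hence
have equal measure. -/
lemma normMeasure_fundDomain (b : P.Base) :
    normMeasure b (fundDomain b) = (Nat.card (weyl b) : ℝ≥0∞)⁻¹ := by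
  have h := (star_isAddFundamentalDomain b).measure_eq (cell_isAddFundamentalDomain b)
  rw [normMeasure_star, normMeasure_cell] at h
  exact ENNReal.eq_inv_of_mul_eq_one_left (by rw [mul_comm]; exact h)

instance domMeasure_isFinite (b : P.Base) : IsFiniteMeasure (domMeasure b) := by
  refine ⟨?_⟩
  rw [domMeasure, Measure.restrict_apply_univ, normMeasure_fundDomain]
  simpa using Fintype.card_pos (α := weyl b)

/-- The integral of a periodic function over the torus is the sum of the integrals over the
translates of the fundamental domain. -/
lemma setIntegral_cell_eq_sum {b : P.Base} {k : E → ℂ} (hc : Continuous k)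
    (hk : ∀ q ∈ corootLattice b, ∀ x, k (x + q) = k x) :
    ∫ x in cell b, k x ∂(normMeasure b) =
      ∑ w : weyl b, ∫ x, k ((w : E ≃ₗ[ℝ] E) x) ∂(domMeasure b) := by
  have hk' : ∀ (q : corootLattice b) (x : E), k (q +ᵥ x) = k x := fun q x => by
    rw [← hk q q.2 x, add_comm]; rfl
  have hint : IntegrableOn k (cell b) (normMeasure b) := by
    have := hc.continuousOn.integrableOn_compact (μ := normMeasure b)
      (ZSpan.fundamentalDomain_isBounded (corootBasis b)).isCompact_closure
    exact this.mono_set subset_closure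
  have hint' : IntegrableOn k (star b) (normMeasure b) :=
    ((star_isAddFundamentalDomain b).integrableOn_iff (cell_isAddFundamentalDomain b) hk').mpr hint
  rw [(cell_isAddFundamentalDomain b).setIntegral_eq (star_isAddFundamentalDomain b) hk', star,
    integral_iUnion (fun w => measurableSet_translate b w⁻¹) (pairwise_disjoint_translates b)
    hint', tsum_fintype]
  refine Finset.sum_congr rfl fun w _ => ?_
  have h := (weyl_measurePreserving w⁻¹).setIntegral_preimage_emb
    (Homeomorph.measurableEmbedding
      (((w⁻¹ : weyl b) : E ≃ₗ[ℝ] E).toContinuousLinearEquiv.toHomeomorph))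
    (fun x => k ((w : E ≃ₗ[ℝ] E) x)) (fundDomain b)
  rw [domMeasure, ← h]
  simp

end Measure

/-! ### Fourier coefficients of smooth periodic functions and their decay. -/

section Fourier

variable {ι E N : Type*} [Finite ι] [NormedAddCommGroup E] [InnerProductSpace ℝ E]
  [FiniteDimensional ℝ E] [AddCommGroup N] [Module ℝ N] {P : RootPairing ι ℝ E N}
  [P.IsRootSystem]

/-- Periodicity under the coroot lattice. -/
def IsPeriodic (b : P.Base) {F : Type*} (k : E → F) : Prop :=
  ∀ q ∈ corootLattice b, ∀ x, k (x + q) = k x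

omit [Finite ι] in
lemma IsPeriodic.bounded {b : P.Base} {F : Type*} [NormedAddCommGroup F] {k : E → F}
    (hk : IsPeriodic b k) (hc : Continuous k) : ∃ C, ∀ x, ‖k x‖ ≤ C := by
  obtain ⟨C, hC⟩ := (ZSpan.fundamentalDomain_isBounded (corootBasis b)).isCompact_closure.bddAbove_image
    (f := fun x => ‖k x‖) (by fun_prop)
  refine ⟨C, fun x => ?_⟩
  have h1 : k (ZSpan.fract (corootBasis b) x) = k x := by
    rw [ZSpan.fract_apply, sub_eq_add_neg]
    exact hk _ (neg_mem (ZSpan.floor (corootBasis b) x).2) x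
  rw [← h1]
  exact hC ⟨_, subset_closure (ZSpan.fract_mem_fundamentalDomain (corootBasis b) x), rfl⟩

omit [Finite ι] [FiniteDimensional ℝ E] in
lemma IsPeriodic.fderiv {b : P.Base} {f : E → ℂ} (hf : IsPeriodic b f) :
    IsPeriodic b (fderiv ℝ f) := by
  intro q hq x
  rw [← fderiv_comp_add_right]
  congr 1
  ext y
  exact hf q hq y

omit [Finite ι] [FiniteDimensional ℝ E] in
lemma isPeriodic_character {b : P.Base} {μ : E} (hμ : μ ∈ weights b) :
    IsPeriodic b (character μ) :=
  fun _ hq x => character_add_lattice hμ hq x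

omit [FiniteDimensional ℝ E] in
lemma contDiff_character (μ : E) : ContDiff ℝ ∞ (character μ) := by
  unfold character
  have : ContDiff ℝ ∞ fun x : E => (⟪μ, x⟫_ℝ : ℂ) :=
    Complex.ofRealCLM.contDiff.comp (contDiff_const.inner ℝ contDiff_id)
  exact (contDiff_const.mul this).cexp

omit [FiniteDimensional ℝ E] in
lemma hasFDerivAt_character (μ x v : E) :
    fderiv ℝ (character μ) x v = 2 * Real.pi * Complex.I * ⟪μ, v⟫_ℝ * character μ x := by
  have h1 : HasFDerivAt (fun x : E => (⟪μ, x⟫_ℝ : ℂ)) (Complex.ofRealCLM ∘L innerSL ℝ μ) x :=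
    (Complex.ofRealCLM ∘L innerSL ℝ μ).hasFDerivAt
  have h2 := (h1.const_mul (2 * Real.pi * Complex.I)).cexp
  have h3 : fderiv ℝ (character μ) x = _ := h2.fderiv
  rw [h3]
  simp [character]
  ring

omit [Finite ι] [FiniteDimensional ℝ E] [P.IsRootSystem] in
lemma neg_mem_weights {b : P.Base} {μ : E} (hμ : μ ∈ weights b) : -μ ∈ weights b := by
  intro i hi
  obtain ⟨m, hm⟩ := hμ i hi
  exact ⟨-m, by rw [inner_neg_left, hm]; simp⟩

omit [Finite ι] [FiniteDimensional ℝ E] [P.IsRootSystem] in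
lemma add_mem_weights {b : P.Base} {μ κ : E} (hμ : μ ∈ weights b) (hκ : κ ∈ weights b) :
    μ + κ ∈ weights b := by
  intro i hi
  obtain ⟨m, hm⟩ := hμ i hi
  obtain ⟨n, hn⟩ := hκ i hi
  exact ⟨m + n, by rw [inner_add_left, hm, hn]; simp⟩

variable [MeasurableSpace E] [BorelSpace E]

instance cell_isFinite (b : P.Base) : IsFiniteMeasure ((normMeasure b).restrict (cell b)) :=
  ⟨by rw [Measure.restrict_apply_univ, normMeasure_cell]; exact ENNReal.one_lt_top⟩

/-- The integral of a derivative of a periodic function over the torus vanishes. -/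
lemma setIntegral_cell_fderiv {b : P.Base} {g : E → ℂ} (hg : ContDiff ℝ ∞ g)
    (hp : IsPeriodic b g) (v : E) :
    ∫ x in cell b, fderiv ℝ g x v ∂(normMeasure b) = 0 := by
  have hd : Differentiable ℝ g := hg.differentiable (by simp)
  have hcd : Continuous (fderiv ℝ g) := hg.continuous_fderiv (by simp)
  obtain ⟨C, hC⟩ := hp.fderiv.bounded hcd
  obtain ⟨C', hC'⟩ := hp.bounded hg.continuous
  -- Differentiate `t ↦ ∫ g(x + t v)` at 0 under the integral sign; by translation invariance this
  -- function is constant.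
  have key := hasDerivAt_integral_of_dominated_loc_of_deriv_le
    (μ := (normMeasure b).restrict (cell b)) (F := fun (t : ℝ) (x : E) => g (x + t • v))
    (F' := fun t x => fderiv ℝ g (x + t • v) v) (x₀ := 0) (s := univ)
    (bound := fun _ => C * ‖v‖) Filter.univ_mem
    (Filter.Eventually.of_forall fun t =>
      (hg.continuous.comp (by fun_prop)).aestronglyMeasurable)
    (Integrable.of_bound (hg.continuous.comp (by fun_prop)).aestronglyMeasurable C'
      (Filter.Eventually.of_forall fun x => hC' _))
    (by
      have : Continuous fun x => fderiv ℝ g (x + (0 : ℝ) • v) v := by fun_prop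
      exact this.aestronglyMeasurable)
    (Filter.Eventually.of_forall fun x t _ =>
      ((fderiv ℝ g (x + t • v)).le_opNorm v).trans
        (mul_le_mul_of_nonneg_right (hC _) (norm_nonneg v)))
    (integrable_const _)
    (Filter.Eventually.of_forall fun x t _ => by
      have h1 : HasDerivAt (fun t : ℝ => x + t • v) v t := by
        simpa using ((hasDerivAt_id t).smul_const v).const_add x
      exact (hd (x + t • v)).hasFDerivAt.comp_hasDerivAt t h1)
  have h2 := key.2
  simp only [setIntegral_cell_add hp, zero_smul, add_zero] at h2
  exact h2.unique (hasDerivAt_const _ _)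

/-- The Fourier coefficient of a periodic function. -/
def fourierCoef (b : P.Base) (f : E → ℂ) (μ : E) : ℂ :=
  ∫ x in cell b, f x * character (-μ) x ∂(normMeasure b)

/-- Integration by parts: the derivative of the product of `f` and the character integrates to zero.
-/
lemma fourierCoef_fderiv {b : P.Base} {f : E → ℂ} (hf : ContDiff ℝ ∞ f) (hp : IsPeriodic b f)
    {μ : E} (hμ : μ ∈ weights b) (v : E) :
    fourierCoef b (fun x => fderiv ℝ f x v) μ =
      2 * Real.pi * Complex.I * ⟪μ, v⟫_ℝ * fourierCoef b f μ := by
  have hchar := contDiff_character (-μ)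
  have hpchar := isPeriodic_character (neg_mem_weights hμ)
  have h := setIntegral_cell_fderiv (b := b) (hf.mul hchar)
    (fun q hq x => by simp only [hp q hq, hpchar q hq]) v
  have hdf : Differentiable ℝ f := hf.differentiable (by simp)
  have hdc : Differentiable ℝ (character (-μ)) := hchar.differentiable (by simp)
  have hcd : Continuous (fderiv ℝ f) := hf.continuous_fderiv (by simp)
  have hprod : ∀ x, fderiv ℝ (fun x => f x * character (-μ) x) x v =
      fderiv ℝ f x v * character (-μ) x -
        2 * Real.pi * Complex.I * ⟪μ, v⟫_ℝ * (f x * character (-μ) x) := by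
    intro x
    rw [fderiv_fun_mul (hdf x) (hdc x)]
    simp only [add_apply, smul_apply,
      hasFDerivAt_character, inner_neg_left, smul_eq_mul]
    push_cast
    ring
  have hint : ∀ k : E → ℂ, Continuous k → IntegrableOn k (cell b) (normMeasure b) := fun k hk =>
    (hk.continuousOn.integrableOn_compact
      (ZSpan.fundamentalDomain_isBounded (corootBasis b)).isCompact_closure).mono_set subset_closure
  have hfc := hf.continuous
  simp only [hprod] at h
  rw [integral_sub (hint _ (by fun_prop)) (hint _ (by fun_prop)), integral_const_mul] at h
  exact sub_eq_zero.mp h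

lemma norm_fourierCoef_le {b : P.Base} {f : E → ℂ} {C : ℝ} (hC : ∀ x, ‖f x‖ ≤ C) (μ : E) :
    ‖fourierCoef b f μ‖ ≤ C := by
  have := norm_setIntegral_le_of_norm_le_const (μ := normMeasure b) (s := cell b) (C := C)
    (f := fun x => f x * character (-μ) x) (by rw [normMeasure_cell]; exact ENNReal.one_lt_top)
    (fun x _ => by rw [norm_mul, norm_character, mul_one]; exact hC x)
  simpa [fourierCoef, Measure.real, normMeasure_cell] using this

/-- Each derivative in a direction `v` gains a factor `2π|⟨μ, v⟩|`, of which `2π ≥ 1` is dropped. -/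
lemma fourierCoef_decay {b : P.Base} (l : List E) : ∀ {f : E → ℂ}, ContDiff ℝ ∞ f →
    IsPeriodic b f → ∃ C, ∀ μ ∈ weights b,
      (l.map fun v => |⟪μ, v⟫_ℝ|).prod * ‖fourierCoef b f μ‖ ≤ C := by
  induction l with
  | nil =>
    intro f hf hp
    obtain ⟨C, hC⟩ := hp.bounded hf.continuous
    exact ⟨C, fun μ _ => by simpa using norm_fourierCoef_le hC μ⟩
  | cons v l ih =>
    intro f hf hp
    obtain ⟨C, hC⟩ := ih (f := fun x => fderiv ℝ f x v)
      ((hf.fderiv_right (m := ∞) (by simp)).clm_apply contDiff_const)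
      (fun q hq x => by simp only [hp.fderiv q hq])
    refine ⟨C, fun μ hμ => ?_⟩
    have h := hC μ hμ
    rw [fourierCoef_fderiv hf hp hμ, norm_mul, norm_mul, norm_mul, norm_mul, Complex.norm_I,
      Complex.norm_real, Complex.norm_real, Real.norm_eq_abs, Real.norm_eq_abs,
      abs_of_pos Real.pi_pos] at h
    refine le_trans ?_ h
    rw [List.map_cons, List.prod_cons]
    have h0 : 0 ≤ (l.map fun v => |⟪μ, v⟫_ℝ|).prod :=
      List.prod_nonneg fun a ha => by
        obtain ⟨u, -, rfl⟩ := List.mem_map.mp ha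
        exact abs_nonneg _
    have h1 : (1 : ℝ) ≤ ‖(2 : ℂ)‖ * Real.pi * 1 := by
      simp only [Complex.norm_ofNat, mul_one]; linarith [Real.pi_gt_three]
    have h2 : 0 ≤ |⟪μ, v⟫_ℝ| * ‖fourierCoef b f μ‖ := by positivity
    calc _ = (l.map fun v => |⟪μ, v⟫_ℝ|).prod * (1 * (|⟪μ, v⟫_ℝ| * ‖fourierCoef b f μ‖)) := by ring
      _ ≤ (l.map fun v => |⟪μ, v⟫_ℝ|).prod *
          (‖(2 : ℂ)‖ * Real.pi * 1 * (|⟪μ, v⟫_ℝ| * ‖fourierCoef b f μ‖)) := by gcongr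
      _ = _ := by ring

end Fourier

/-- A finite set of multi-indices sits in a box, over which the sum factors. -/
lemma summable_prod_pi {J : Type*} [Fintype J] {g : ℕ → ℝ} (h0 : ∀ n, 0 ≤ g n)
    (hg : Summable g) : Summable fun m : J → ℕ => ∏ j, g (m j) := by
  classical
  refine summable_of_sum_le (c := ∏ _j : J, ∑' n, g n)
    (fun m => Finset.prod_nonneg fun j _ => h0 _) fun S => ?_
  have hsub : S ⊆ Fintype.piFinset fun j => S.image fun m => m j := fun m hm =>
    Fintype.mem_piFinset.mpr fun j => Finset.mem_image_of_mem _ hm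
  refine (Finset.sum_le_sum_of_subset_of_nonneg hsub
    fun m _ _ => Finset.prod_nonneg fun j _ => h0 _).trans ?_
  rw [← Finset.prod_univ_sum]
  exact Finset.prod_le_prod (fun j _ => Finset.sum_nonneg fun n _ => h0 _)
    fun j _ => hg.sum_le_tsum _ fun n _ => h0 n

/-! ### Summability of the coefficients and orthonormality. -/

section Coefficients

variable {ι E N : Type*} [Finite ι] [NormedAddCommGroup E] [InnerProductSpace ℝ E]
  [FiniteDimensional ℝ E] [MeasurableSpace E] [BorelSpace E]
  [AddCommGroup N] [Module ℝ N] {P : RootPairing ι ℝ E N} [P.IsRootSystem]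

lemma fourierCoef_character {b : P.Base} {κ μ : E} (hκ : κ ∈ weights b) (hμ : μ ∈ weights b) :
    fourierCoef b (character κ) μ = open Classical in if κ = μ then 1 else 0 := by
  have h := setIntegral_cell_character (add_mem_weights hκ (neg_mem_weights hμ))
  simp only [character_add_left] at h
  rw [fourierCoef, h, ← sub_eq_add_neg]
  by_cases hκμ : κ = μ
  · simp [hκμ]
  · rw [if_neg (sub_ne_zero.mpr hκμ), if_neg hκμ]

omit [Finite ι] [FiniteDimensional ℝ E] [MeasurableSpace E] [BorelSpace E] in
/-- A strictly dominant weight is determined by its pairings with the simple coroots. -/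
lemma exists_injective_label (b : P.Base) : ∃ m : strictWeights b → b.support → ℕ,
    Function.Injective m ∧ ∀ (μ : strictWeights b) (i : b.support), ⟪(μ : E), corootVec P (i : ι)⟫_ℝ = m μ i := by
  choose m hm0 hm using fun (μ : strictWeights b) (i : b.support) => μ.2 i i.2
  refine ⟨m, fun μ κ h => Subtype.ext ?_, hm⟩
  have hlin : innerₛₗ ℝ (μ : E) = innerₛₗ ℝ (κ : E) :=
    (corootBasis b).ext fun i => by simp [hm, h]
  exact ext_inner_right ℝ fun x => LinearMap.congr_fun hlin x

omit [Finite ι] [FiniteDimensional ℝ E] [MeasurableSpace E] [BorelSpace E]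
  [P.IsRootSystem] in
lemma exists_list_prod_eq (b : P.Base) : ∃ l : List E, ∀ μ : E,
    (l.map fun v => |⟪μ, v⟫_ℝ|).prod = ∏ i : b.support, ⟪μ, corootVec P (i : ι)⟫_ℝ ^ 2 := by
  let l : List E := (Finset.univ : Finset b.support).toList.map
    fun i : b.support => corootVec P (i : ι)
  -- Each simple coroot is used twice, so that the decay is quadratic in every coordinate and hence
  -- summable.
  refine ⟨l ++ l, fun μ => ?_⟩
  have : (l.map fun v => |⟪μ, v⟫_ℝ|).prod = ∏ i : b.support, |⟪μ, corootVec P (i : ι)⟫_ℝ| := by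
    rw [List.map_map, Finset.prod_map_toList]
    rfl
  rw [List.map_append, List.prod_append, this, ← sq, ← Finset.prod_pow]
  exact Finset.prod_congr rfl fun i _ => sq_abs _

lemma summable_fourierCoef {b : P.Base} {f : E → ℂ} (hf : ContDiff ℝ ∞ f) (hp : IsPeriodic b f) :
    Summable fun μ : strictWeights b => ‖fourierCoef b f μ‖ := by
  obtain ⟨m, hinj, hm⟩ := exists_injective_label b
  obtain ⟨l, hl⟩ := exists_list_prod_eq b
  obtain ⟨C, hC⟩ := fourierCoef_decay (b := b) l hf hp
  -- Multi-indices with a zero coordinate contribute 0, since `1 / 0 = 0`; labels of strictly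
  -- dominant weights have positive coordinates.
  have hsum : Summable fun k : b.support → ℕ => ∏ j, 1 / (k j : ℝ) ^ 2 :=
    summable_prod_pi (g := fun n : ℕ => 1 / (n : ℝ) ^ 2) (fun n => by positivity)
      (Real.summable_one_div_nat_pow.mpr one_lt_two)
  refine Summable.of_nonneg_of_le (fun _ => norm_nonneg _) (fun μ => ?_)
    ((hsum.comp_injective hinj).mul_left C)
  have h := hC μ (strictWeights_subset_weights b μ.2)
  have hprod : 0 < ∏ i : b.support, ⟪(μ : E), corootVec P (i : ι)⟫_ℝ ^ 2 :=
    Finset.prod_pos fun i _ =>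
      pow_pos ((inner_corootVec_pos_iff _ _).mpr (strictWeights_inner_pos μ.2 i.2)) 2
  rw [hl, mul_comm, ← le_div_iff₀ hprod] at h
  refine h.trans_eq ?_
  simp only [Function.comp_apply, Finset.prod_inv_distrib, hm, div_eq_mul_inv, one_mul]

variable [P.IsCrystallographic] [P.IsReduced] [IsEuclidean P]

/-- The coefficients of an anti-invariant function are its Fourier coefficients. -/
lemma coeff_eq_fourierCoef {b : P.Base} {f : E → ℂ} (hc : Continuous f) (hp : IsPeriodic b f)
    (ha : ∀ w ∈ weyl b, ∀ x, f (w x) = detC w * f x) {μ : E} (hμ : μ ∈ weights b) :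
    coeff b f μ = fourierCoef b f μ := by
  have hpc := isPeriodic_character (neg_mem_weights hμ)
  rw [fourierCoef, setIntegral_cell_eq_sum (by fun_prop)
    (fun q hq x => by simp only [hp q hq, hpc q hq]), ← integral_finsetSum, coeff]
  · congr 1
    ext x
    rw [orbitFun_eq_sum, map_sum, Finset.mul_sum]
    -- On the tile of `w`, anti-invariance produces `det w` and moving `w` across the scalar product
    -- turns `-μ` into `-w⁻¹ μ`; reindexing by inverses gives the conjugate of `φ_μ`.
    refine Fintype.sum_equiv (Equiv.inv _) _ _ fun w => ?_
    simp only [Equiv.inv_apply, map_mul, conj_detC, conj_character]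
    rw [ha _ (w⁻¹).2, character_weyl (w⁻¹).2, Subgroup.coe_inv, inv_inv, map_neg, detC_inv w.2]
    ring
  · intro w _
    obtain ⟨C, hC⟩ := hp.bounded hc
    have hw : Continuous (w : E ≃ₗ[ℝ] E) :=
      LinearMap.continuous_of_finiteDimensional ((w : E ≃ₗ[ℝ] E) : E →ₗ[ℝ] E)
    refine Integrable.of_bound (by
      have : Continuous fun x => f ((w : E ≃ₗ[ℝ] E) x) *
        character (-μ) ((w : E ≃ₗ[ℝ] E) x) := by fun_prop
      exact this.aestronglyMeasurable) C (Filter.Eventually.of_forall fun x => ?_)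
    rw [norm_mul, norm_character, mul_one]
    exact hC _

/-- Only the terms with `w κ = μ` survive the orthogonality of characters; for strictly dominant
weights this forces `w = 1` and `κ = μ`. -/
lemma coeff_orbitFun {b : P.Base} (κ μ : strictWeights b) :
    coeff b (orbitFun b κ) μ = open Classical in if κ = μ then 1 else 0 := by
  have hκ := strictWeights_subset_weights b κ.2
  have hμ := strictWeights_subset_weights b μ.2
  rw [coeff_eq_fourierCoef (continuous_orbitFun b κ) (fun q hq x => orbitFun_add_lattice hκ hq x)
    (fun w hw x => orbitFun_weyl_right hw κ x) hμ]
  have h1 : fourierCoef b (orbitFun b κ) μ =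
      ∑ w : weyl b, detC (w : E ≃ₗ[ℝ] E) *
        fourierCoef b (character ((w : E ≃ₗ[ℝ] E) κ)) μ := by
    simp only [fourierCoef, orbitFun_eq_sum, Finset.sum_mul, mul_assoc]
    rw [integral_finsetSum]
    · simp only [integral_const_mul]
    · intro w _
      have : Continuous fun x => detC (w : E ≃ₗ[ℝ] E) *
        (character ((w : E ≃ₗ[ℝ] E) κ) x * character (-(μ : E)) x) := by fun_prop
      refine Integrable.of_bound this.aestronglyMeasurable 1
        (Filter.Eventually.of_forall fun x => ?_)
      simp [norm_character, norm_detC w.2]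
  rw [h1, Finset.sum_eq_single 1]
  · simp only [Subgroup.coe_one, detC_one, one_mul]
    rw [show (1 : E ≃ₗ[ℝ] E) (κ : E) = κ from rfl, fourierCoef_character hκ hμ]
    by_cases h : κ = μ
    · simp [h]
    · rw [if_neg h, if_neg fun h' => h (Subtype.ext h')]
  · intro w _ hw
    rw [fourierCoef_character (weyl_mem_weights w.2 hκ) hμ, if_neg, mul_zero]
    intro h
    exact hw (Subtype.ext (weyl_eq_of_strictWeights w.2 (one_mem _) κ.2 μ.2 h).1)
  · simp

end Coefficients

/-! ### Uniform approximation and totality of the orbit functions. -/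

section Density

variable {ι E N : Type*} [Finite ι] [NormedAddCommGroup E] [InnerProductSpace ℝ E]
  [FiniteDimensional ℝ E] [AddCommGroup N] [Module ℝ N] {P : RootPairing ι ℝ E N}
  [P.IsRootSystem]

omit [Finite ι] in
lemma exists_weight_eq (b : P.Base) (n : b.support → ℤ) :
    ∃ μ ∈ weights b, ∀ i : b.support, ⟪μ, corootVec P (i : ι)⟫_ℝ = n i := by
  classical
  obtain ⟨μ, hμ⟩ := exists_inner_root_eq b fun i =>
    if hi : i ∈ b.support then n ⟨i, hi⟩ * (⟪P.root i, P.root i⟫_ℝ / 2) else 0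
  have h : ∀ i : b.support, ⟪μ, corootVec P (i : ι)⟫_ℝ = n i := fun i => by
    have hpos := inner_root_self_pos (P := P) i
    rw [corootVec, real_inner_smul_right, hμ i i.2, dif_pos i.2]
    field_simp
  exact ⟨μ, fun i hi => ⟨n ⟨i, hi⟩, h ⟨i, hi⟩⟩, h⟩

/-- The projection of the Euclidean space onto the torus. -/
def toTorus (b : P.Base) : C(E, UnitAddTorus b.support) where
  toFun x i := ((corootBasis b).repr x i : ℝ)
  continuous_toFun := by
    refine continuous_pi fun i => (AddCircle.continuous_mk' 1).comp ?_
    exact LinearMap.continuous_of_finiteDimensional ((corootBasis b).coord i)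

omit [Finite ι] in
-- Lets continuous periodic functions descend to the standard torus, where trigonometric polynomials
-- are dense.
lemma toTorus_isQuotientMap (b : P.Base) : Topology.IsQuotientMap (toTorus b) := by
  have h1 : IsOpenQuotientMap
      (Pi.map fun (_ : b.support) (t : ℝ) => (t : UnitAddCircle)) :=
    IsOpenQuotientMap.piMap fun _ => QuotientAddGroup.isOpenQuotientMap_mk
  exact h1.isQuotientMap.comp
    (corootBasis b).equivFun.toContinuousLinearEquiv.toHomeomorph.isQuotientMap

omit [Finite ι] [FiniteDimensional ℝ E] in
lemma IsPeriodic.eq_of_repr {b : P.Base} {k : E → ℂ} (hk : IsPeriodic b k) {x y : E}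
    (h : ∀ i, (((corootBasis b).repr x i : ℝ) : UnitAddCircle) = ((corootBasis b).repr y i : ℝ)) :
    k x = k y := by
  have hn : ∀ i, ∃ n : ℤ, (corootBasis b).repr y i - (corootBasis b).repr x i = n := fun i => by
    obtain ⟨n, hn⟩ := (QuotientAddGroup.eq.mp (h i))
    exact ⟨n, by simpa [neg_add_eq_sub] using hn.symm⟩
  choose n hn using hn
  have hq : y - x ∈ corootLattice b := by
    rw [← (corootBasis b).sum_repr (y - x)]
    refine Submodule.sum_mem _ fun i _ => ?_
    rw [map_sub, Finsupp.sub_apply, hn, Int.cast_smul_eq_zsmul]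
    exact Submodule.smul_mem _ _ (Submodule.subset_span ⟨i, rfl⟩)
  rw [← hk _ hq x, add_sub_cancel]

omit [Finite ι] [FiniteDimensional ℝ E] in
lemma mFourier_repr (b : P.Base) {μ : E} {n : b.support → ℤ}
    (h : ∀ i : b.support, ⟪μ, corootVec P (i : ι)⟫_ℝ = n i) (x : E) :
    UnitAddTorus.mFourier n (fun i => (((corootBasis b).repr x i : ℝ) : UnitAddCircle)) =
      character μ x := by
  have hx : ⟪μ, x⟫_ℝ = ∑ i, (corootBasis b).repr x i * n i := by
    conv_lhs => rw [← (corootBasis b).sum_repr x]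
    rw [inner_sum]
    exact Finset.sum_congr rfl fun i _ => by rw [real_inner_smul_right, corootBasis_apply, h]
  simp only [UnitAddTorus.mFourier, ContinuousMap.coe_mk, fourier_coe_apply]
  rw [← Complex.exp_sum, character, hx]
  congr 1
  push_cast
  rw [Finset.mul_sum]
  exact Finset.sum_congr rfl fun i _ => by ring

omit [Finite ι] in
/-- Continuous periodic functions are uniform limits of trigonometric polynomials. -/
lemma IsPeriodic.exists_approx {b : P.Base} {k : E → ℂ} (hk : IsPeriodic b k) (hc : Continuous k)
    {ε : ℝ} (hε : 0 < ε) :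
    ∃ p ∈ Submodule.span ℂ (character '' weights b), ∀ x, ‖k x - p x‖ ≤ ε := by
  have hfac : Function.FactorsThrough (⟨k, hc⟩ : C(E, ℂ)) (toTorus b) := fun x y h =>
    hk.eq_of_repr fun i => congrFun h i
  let K : C(UnitAddTorus b.support, ℂ) := (toTorus_isQuotientMap b).lift ⟨k, hc⟩ hfac
  have hK : ∀ x, K (toTorus b x) = k x := fun x =>
    ContinuousMap.congr_fun ((toTorus_isQuotientMap b).lift_comp ⟨k, hc⟩ hfac) x
  have hmem : K ∈ (Submodule.span ℂ
      (range (UnitAddTorus.mFourier (d := b.support)))).topologicalClosure := by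
    rw [UnitAddTorus.span_mFourier_closure_eq_top]; trivial
  obtain ⟨p, hp, hdist⟩ := Metric.mem_closure_iff.mp hmem ε hε
  refine ⟨fun x => p (toTorus b x), ?_, fun x => ?_⟩
  · clear hdist
    induction hp using Submodule.span_induction with
    | mem _ h =>
      obtain ⟨n, rfl⟩ := h
      obtain ⟨μ, hμ, h⟩ := exists_weight_eq b n
      exact Submodule.subset_span ⟨μ, hμ, funext fun x => (mFourier_repr b h x).symm⟩
    | zero => exact zero_mem _
    | add f g _ _ hf hg => exact add_mem hf hg
    | smul a f _ hf => exact Submodule.smul_mem _ a hf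
  · rw [← hK, ← dist_eq_norm]
    exact (ContinuousMap.dist_apply_le_dist _).trans hdist.le

/-- The sum of the translates of a function under the coroot lattice. -/
def periodize (b : P.Base) (ψ : E → ℂ) (x : E) : ℂ := ∑ᶠ q : corootLattice b, ψ (x + q)

omit [Finite ι] [FiniteDimensional ℝ E] in
lemma isPeriodic_periodize (b : P.Base) (ψ : E → ℂ) : IsPeriodic b (periodize b ψ) := by
  intro q hq x
  rw [periodize, periodize,
    ← finsum_comp_equiv (Equiv.addLeft (⟨q, hq⟩ : corootLattice b)) (f := fun r => ψ (x + r))]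
  refine finsum_congr fun r => ?_
  simp [add_assoc]

open scoped Pointwise in
omit [Finite ι] in
lemma continuous_periodize (b : P.Base) {ψ : E → ℂ} (hψ : Continuous ψ)
    (hs : HasCompactSupport ψ) : Continuous (periodize b ψ) := by
  refine continuous_finsum (fun q => by fun_prop) fun x => ?_
  refine ⟨Metric.ball x 1, Metric.ball_mem_nhds x one_pos, ?_⟩
  -- Local finiteness: near `x` only lattice vectors in the bounded set `supp ψ - B(x, 1)`
  -- contribute.
  have hbdd : Bornology.IsBounded (tsupport ψ - Metric.ball x 1) :=
    hs.isCompact.isBounded.sub Metric.isBounded_ball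
  have hfin := ZSpan.setFinite_inter (corootBasis b) hbdd
  refine (hfin.preimage Subtype.val_injective.injOn).subset ?_
  rintro q ⟨y, hy, hyx⟩
  refine ⟨⟨y + q, subset_tsupport _ hy, y, hyx, by simp⟩, q.2⟩

variable [P.IsCrystallographic] [P.IsReduced] [IsEuclidean P]

/-- No lattice translate of `wF` meets `F` when `w ≠ 1`, and for `w = 1` only the zero translate
does. -/
lemma periodize_weyl {b : P.Base} {ψ : E → ℂ} (hs : Function.support ψ ⊆ fundDomain b) {x : E}
    (hx : x ∈ fundDomain b) (w : weyl b) :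
    periodize b ψ ((w : E ≃ₗ[ℝ] E) x) = open Classical in if w = 1 then ψ x else 0 := by
  have key : ∀ q : corootLattice b, ψ ((w : E ≃ₗ[ℝ] E) x + q) ≠ 0 → w = 1 ∧ q = 0 := by
    intro q hq
    have := weyl_eq_one_and_eq_zero w.2 q.2 hx (hs hq)
    exact ⟨Subtype.ext this.1, Subtype.ext this.2⟩
  rw [periodize, finsum_eq_single _ 0 fun q hq => by
    by_contra h
    exact hq (key q h).2]
  by_cases hw : w = 1
  · simp [hw]
  · rw [if_neg hw]
    by_contra h
    exact hw (key 0 h).1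

/-- Functions with compact support in the fundamental domain are there uniform limits of
linear combinations of orbit functions. -/
lemma exists_orbitFun_approx {b : P.Base} {ψ : E → ℂ} (hψ : Continuous ψ)
    (hc : HasCompactSupport ψ) (hs : Function.support ψ ⊆ fundDomain b) {ε : ℝ} (hε : 0 < ε) :
    ∃ p ∈ Submodule.span ℂ (range fun κ : strictWeights b => orbitFun b (κ : E)),
      ∀ x ∈ fundDomain b, ‖ψ x - p x‖ ≤ ε := by
  have hcard : (0 : ℝ) < Nat.card (weyl b) := by exact_mod_cast Nat.card_pos
  obtain ⟨p, hp, happ⟩ := (isPeriodic_periodize b ψ).exists_approx (continuous_periodize b hψ hc)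
    (div_pos hε hcard)
  -- Antisymmetrization turns the character of `μ` into `φ_μ`. It turns the periodized `ψ` back into
  -- `ψ` on `F`, because only `w = 1` contributes there; the `|W|` errors add up to `ε`.
  refine ⟨fun x => ∑ w : weyl b, detC (w : E ≃ₗ[ℝ] E) * p ((w : E ≃ₗ[ℝ] E) x), ?_, ?_⟩
  · clear happ
    induction hp using Submodule.span_induction with
    | mem _ h =>
      obtain ⟨μ, hμ, rfl⟩ := h
      convert orbitFun_mem_span hμ using 1
      ext x
      rw [orbitFun_eq_sum]
      refine Fintype.sum_equiv (Equiv.inv _) _ _ fun w => ?_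
      simp only [Equiv.inv_apply]
      rw [character_weyl w.2, Subgroup.coe_inv, detC_inv w.2]
    | zero => simpa using! zero_mem _
    | add f g _ _ hf hg =>
      convert add_mem hf hg using 1
      ext x
      simp [mul_add, Finset.sum_add_distrib]
    | smul a f _ hf =>
      convert Submodule.smul_mem _ a hf using 1
      ext x
      simp only [Pi.smul_apply, smul_eq_mul, Finset.mul_sum]
      exact Finset.sum_congr rfl fun w _ => by ring
  · intro x hx
    have h1 : ψ x = ∑ w : weyl b,
        detC (w : E ≃ₗ[ℝ] E) * periodize b ψ ((w : E ≃ₗ[ℝ] E) x) := by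
      classical
      simp only [periodize_weyl hs hx]
      rw [Finset.sum_eq_single 1 (fun w _ hw => by simp [hw]) (by simp)]
      simp [detC_one]
    rw [h1, ← Finset.sum_sub_distrib]
    refine (norm_sum_le _ _).trans ((Finset.sum_le_sum (g := fun _ => ε / Nat.card (weyl b))
      fun w _ => ?_).trans ?_)
    · rw [← mul_sub, norm_mul, norm_detC w.2, one_mul]
      exact happ _
    · rw [Finset.sum_const, Finset.card_univ, ← Nat.card_eq_fintype_card, nsmul_eq_mul,
        mul_div_cancel₀ _ hcard.ne']

variable [MeasurableSpace E] [BorelSpace E]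

/-- A function orthogonal to all orbit functions vanishes. -/
lemma ae_eq_zero_of_forall_integral {b : P.Base} {g : E → ℂ} (hg : Integrable g (domMeasure b))
    (h : ∀ μ : strictWeights b, ∫ x, g x * conj (orbitFun b μ x) ∂(domMeasure b) = 0) :
    g =ᵐ[domMeasure b] 0 := by
  have hspan : ∀ p ∈ Submodule.span ℂ (range fun κ : strictWeights b => orbitFun b (κ : E)),
      Integrable (fun x => g x * conj (p x)) (domMeasure b) ∧
        ∫ x, g x * conj (p x) ∂(domMeasure b) = 0 := by
    intro p hp
    induction hp using Submodule.span_induction with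
    | mem _ hκ =>
      obtain ⟨κ, rfl⟩ := hκ
      refine ⟨?_, h κ⟩
      have hcont : Continuous fun x => conj (orbitFun b κ x) :=
        Complex.continuous_conj.comp (continuous_orbitFun b κ)
      refine hg.mul_bdd (c := Nat.card (weyl b)) hcont.aestronglyMeasurable
        (Filter.Eventually.of_forall fun x => ?_)
      rw [RCLike.norm_conj]
      exact norm_orbitFun_le b κ x
    | zero => simp
    | add p r _ _ hp hr =>
      simp only [Pi.add_apply, map_add, mul_add]
      exact ⟨hp.1.add hr.1, by rw [integral_add hp.1 hr.1, hp.2, hr.2, add_zero]⟩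
    | smul a p _ hp =>
      simp only [Pi.smul_apply, smul_eq_mul, map_mul, mul_left_comm (g _)]
      exact ⟨hp.1.const_mul _, by rw [integral_const_mul, hp.2, mul_zero]⟩
  -- It suffices to test `g` against smooth functions compactly supported in `F`.
  have hzero : ∀ ψ : E → ℝ, ContDiff ℝ ∞ ψ → HasCompactSupport ψ → tsupport ψ ⊆ fundDomain b →
      ∫ x, ψ x • g x ∂(domMeasure b) = 0 := by
    intro ψ hψ hcs hs
    have hψint : Integrable (fun x => ψ x • g x) (domMeasure b) := by
      obtain ⟨C, hC⟩ := hψ.continuous.bounded_above_of_compact_support hcs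
      exact hg.bdd_smul (C := C) hψ.continuous.aestronglyMeasurable
        (Filter.Eventually.of_forall hC)
    -- Subtracting the vanishing integral of `g conj(p)` leaves `conj(ψ - p) g`, as `ψ` is real, and
    -- `p` is within `ε` of `ψ` on `F`.
    have hle : ∀ ε : ℝ, 0 < ε →
        ‖∫ x, ψ x • g x ∂(domMeasure b)‖ ≤ ε * ∫ x, ‖g x‖ ∂(domMeasure b) := by
      intro ε hε
      obtain ⟨p, hp, happ⟩ := exists_orbitFun_approx (b := b) (ψ := fun x => (ψ x : ℂ))
        (Complex.continuous_ofReal.comp hψ.continuous)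
        (hcs.comp_left (g := ((↑) : ℝ → ℂ)) Complex.ofReal_zero)
        (fun x hx => hs (subset_tsupport _ fun h0 => hx (by simp [h0]))) hε
      obtain ⟨hi, h0⟩ := hspan p hp
      have : ∫ x, ψ x • g x ∂(domMeasure b) =
          ∫ x, (ψ x • g x - g x * conj (p x)) ∂(domMeasure b) := by
        rw [integral_sub hψint hi, h0, sub_zero]
      rw [this, ← integral_const_mul]
      refine norm_integral_le_of_norm_le (hg.norm.const_mul ε) ?_
      filter_upwards [ae_restrict_mem (fundDomain_isOpen b).measurableSet] with x hx
      have h1 : ψ x • g x - g x * conj (p x) = conj ((ψ x : ℂ) - p x) * g x := by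
        rw [map_sub, Complex.conj_ofReal, Complex.real_smul]; ring
      rw [h1, norm_mul, RCLike.norm_conj]
      exact mul_le_mul_of_nonneg_right (happ x hx) (norm_nonneg _)
    refine norm_le_zero_iff.mp (le_of_forall_pos_le_add fun ε hε => ?_)
    have hI : 0 ≤ ∫ x, ‖g x‖ ∂(domMeasure b) := integral_nonneg fun _ => norm_nonneg _
    refine (hle (ε / (∫ x, ‖g x‖ ∂(domMeasure b) + 1)) (by positivity)).trans ?_
    rw [zero_add, div_mul_eq_mul_div, div_le_iff₀ (by positivity)]
    nlinarith
  have := (fundDomain_isOpen b).ae_eq_zero_of_integral_contDiff_smul_eq_zero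
    (hg.locallyIntegrable.locallyIntegrableOn _) hzero
  filter_upwards [this, ae_restrict_mem (fundDomain_isOpen b).measurableSet] with x h1 h2
  exact h1 h2

end Density

/-! ### The Hilbert basis, Plancherel and pointwise convergence. -/

section HilbertBasis

variable {ι E N : Type*} [Finite ι] [NormedAddCommGroup E] [InnerProductSpace ℝ E]
  [FiniteDimensional ℝ E] [MeasurableSpace E] [BorelSpace E] [AddCommGroup N] [Module ℝ N]
  {P : RootPairing ι ℝ E N} [P.IsRootSystem] [P.IsCrystallographic] [P.IsReduced] [IsEuclidean P]

lemma memLp_of_bounded {b : P.Base} {f : E → ℂ} (hf : Continuous f) {C : ℝ}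
    (hC : ∀ x, ‖f x‖ ≤ C) : MemLp f 2 (domMeasure b) :=
  MemLp.of_bound hf.aestronglyMeasurable C (Filter.Eventually.of_forall hC)

lemma memLp_orbitFun (b : P.Base) (μ : E) : MemLp (orbitFun b μ) 2 (domMeasure b) :=
  memLp_of_bounded (continuous_orbitFun b μ) (norm_orbitFun_le b μ)

/-- The orbit function as an element of `L²(F)`. -/
def orbitLp (b : P.Base) (μ : E) : Lp ℂ 2 (domMeasure b) := (memLp_orbitFun b μ).toLp _

lemma inner_orbitLp (b : P.Base) (μ : E) (g : Lp ℂ 2 (domMeasure b)) :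
    inner ℂ (orbitLp b μ) g = ∫ x, g x * conj (orbitFun b μ x) ∂(domMeasure b) := by
  rw [L2.inner_def]
  refine integral_congr_ae ?_
  filter_upwards [(memLp_orbitFun b μ).coeFn_toLp] with x hx
  rw [orbitLp, hx, RCLike.inner_apply]

lemma inner_orbitLp_toLp (b : P.Base) (μ : E) {f : E → ℂ} (hf : MemLp f 2 (domMeasure b)) :
    inner ℂ (orbitLp b μ) (hf.toLp f) = coeff b f μ := by
  rw [inner_orbitLp, coeff]
  refine integral_congr_ae ?_
  filter_upwards [hf.coeFn_toLp] with x hx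
  rw [hx]

open Classical in
lemma orthonormal_orbitLp (b : P.Base) :
    Orthonormal ℂ fun μ : strictWeights b => orbitLp b (μ : E) := by
  rw [orthonormal_iff_ite]
  intro μ κ
  rw [orbitLp, orbitLp, ← orbitLp, inner_orbitLp_toLp, coeff_orbitFun]
  simp only [eq_comm]

omit [FiniteDimensional ℝ E] [P.IsRootSystem] [P.IsCrystallographic] [P.IsReduced]
  [IsEuclidean P] [MeasurableSpace E] [BorelSpace E] in
lemma exists_affVal_eq_zero {b : P.Base} {x : E} (hx : x ∈ frontier (fundDomain b)) :
    ∃ s ∈ simpleAff b, affVal P s x = 0 := by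
  rw [(fundDomain_isOpen b).frontier_eq] at hx
  obtain ⟨hcl, hn⟩ := hx
  rw [mem_fundDomain_iff] at hn
  push Not at hn
  obtain ⟨s, hs, hle⟩ := hn
  have hsub : fundDomain b ⊆ {x | 0 ≤ affVal P s x} := fun y hy =>
    (mem_fundDomain_iff.mp hy s hs).le
  exact ⟨s, hs, le_antisymm hle
    (closure_minimal hsub (isClosed_le continuous_const (continuous_affVal s)) hcl)⟩

omit [MeasurableSpace E] [BorelSpace E] in
-- A boundary point is fixed by the reflection in some wall, under which `φ_μ` changes sign.
lemma orbitFun_frontier {b : P.Base} {μ : E} (hμ : μ ∈ weights b) {x : E}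
    (hx : x ∈ frontier (fundDomain b)) : orbitFun b μ x = 0 := by
  obtain ⟨s, hs, h0⟩ := exists_affVal_eq_zero hx
  have h1 : P.reflection s.1 x + -((s.2 : ℤ) • corootVec P s.1) = x := by
    rw [← Int.cast_smul_eq_zsmul ℝ, ← affMk_apply, ← affRefl_eq_affMk, affRefl_apply, h0, zero_smul,
      sub_zero]
  have h2 : orbitFun b μ x = -orbitFun b μ x := by
    conv_lhs => rw [← h1]
    rw [orbitFun_add_lattice hμ
      (neg_mem (Submodule.smul_mem _ _ (corootVec_mem_corootLattice b s.1))),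
      orbitFun_weyl_right (reflection_mem_weyl b s.1), detC, det_reflection]
    push_cast
    ring
  linear_combination h2 / 2

omit [Finite ι] [P.IsRootSystem] [P.IsCrystallographic] [P.IsReduced] [IsEuclidean P] in
lemma toLp_mem_L20 {b : P.Base} {f : E → ℂ} (hc : Continuous f)
    (h0 : ∀ x ∈ frontier (fundDomain b), f x = 0) (hf : MemLp f 2 (domMeasure b)) :
    hf.toLp f ∈ L20 b :=
  Submodule.le_topologicalClosure _
    (Submodule.subset_span ⟨f, hc.continuousOn, h0, hf.coeFn_toLp⟩)

lemma orbitLp_mem_L20 {b : P.Base} {μ : E} (hμ : μ ∈ weights b) : orbitLp b μ ∈ L20 b :=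
  toLp_mem_L20 (continuous_orbitFun b μ) (fun _ hx => orbitFun_frontier hμ hx) _

/-- The orbit function as an element of `L²₀(F)`. -/
def orbitL20 (b : P.Base) (μ : strictWeights b) : L20 b :=
  ⟨orbitLp b μ, orbitLp_mem_L20 (strictWeights_subset_weights b μ.2)⟩

lemma orthonormal_orbitL20 (b : P.Base) : Orthonormal ℂ (orbitL20 b) := by
  classical
  have h := orthonormal_iff_ite.mp (orthonormal_orbitLp b)
  exact orthonormal_iff_ite.mpr fun μ κ => h μ κ

instance L20_complete (b : P.Base) : CompleteSpace (L20 b) :=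
  (Submodule.isClosed_topologicalClosure _).completeSpace_coe

/-- The totality argument works for every element of `L²(F)`; the boundary condition matters only
for membership in `L²₀(F)`. -/
lemma span_orbitL20_orthogonal (b : P.Base) :
    (Submodule.span ℂ (range (orbitL20 b)))ᗮ = ⊥ := by
  rw [Submodule.eq_bot_iff]
  intro g hg
  have h : ((g : Lp ℂ 2 (domMeasure b)) : E → ℂ) =ᵐ[domMeasure b] 0 := by
    refine ae_eq_zero_of_forall_integral
      ((Lp.memLp (g : Lp ℂ 2 (domMeasure b))).integrable one_le_two) fun μ => ?_
    rw [← inner_orbitLp]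
    exact hg (orbitL20 b μ) (Submodule.subset_span ⟨μ, rfl⟩)
  exact Subtype.ext ((Lp.eq_zero_iff_ae_eq_zero).mpr h)

/-- The orbit functions of strictly dominant weights form a Hilbert basis of `L²₀(F)`. -/
def orbitBasis (b : P.Base) : HilbertBasis (strictWeights b) ℂ (L20 b) :=
  HilbertBasis.mkOfOrthogonalEqBot (orthonormal_orbitL20 b) (span_orbitL20_orthogonal b)

lemma orbitBasis_apply (b : P.Base) (μ : strictWeights b) : orbitBasis b μ = orbitL20 b μ := by
  rw [orbitBasis, HilbertBasis.coe_mkOfOrthogonalEqBot]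

/-- The Plancherel formula. -/
lemma hasSum_norm_coeff_sq {b : P.Base} {f : E → ℂ} (hc : Continuous f)
    (h0 : ∀ x ∈ frontier (fundDomain b), f x = 0) (hf : MemLp f 2 (domMeasure b)) :
    HasSum (fun μ : strictWeights b => ‖coeff b f μ‖ ^ 2)
      (∫ x, ‖f x‖ ^ 2 ∂(domMeasure b)) := by
  let g : L20 b := ⟨hf.toLp f, toLp_mem_L20 hc h0 hf⟩
  have h := RCLike.hasSum_re ℂ ((orbitBasis b).hasSum_inner_mul_inner g g)
  have h1 : ∀ μ : strictWeights b, inner ℂ (orbitBasis b μ) g = coeff b f μ := fun μ => by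
    rw [orbitBasis_apply]
    exact inner_orbitLp_toLp b μ hf
  have h2 : ∀ μ : strictWeights b,
      RCLike.re (inner ℂ g (orbitBasis b μ) * inner ℂ (orbitBasis b μ) g) =
        ‖coeff b f μ‖ ^ 2 := fun μ => by
    rw [← inner_conj_symm g (orbitBasis b μ), h1, RCLike.conj_mul]
    norm_cast
  have h3 : RCLike.re (inner ℂ g g) = ∫ x, ‖f x‖ ^ 2 ∂(domMeasure b) := by
    have h4 : inner ℂ g g = inner ℂ (hf.toLp f) (hf.toLp f) := rfl
    rw [h4, L2.inner_def]
    have h5 : ∫ x, inner ℂ (hf.toLp f x) (hf.toLp f x) ∂(domMeasure b) =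
        ∫ x, ((‖f x‖ ^ 2 : ℝ) : ℂ) ∂(domMeasure b) := by
      refine integral_congr_ae ?_
      filter_upwards [hf.coeFn_toLp] with x hx
      rw [hx, inner_self_eq_norm_sq_to_K]
      push_cast; rfl
    rw [h5, integral_complex_ofReal]
    exact RCLike.ofReal_re _
  rw [h3] at h
  exact h.congr_fun fun μ => (h2 μ).symm

/-- Orthogonality for Lebesgue measure. -/
lemma volume_orthogonality {b : P.Base} (κ μ : strictWeights b) :
    (((volume (fundDomain b)).toReal⁻¹ : ℝ) : ℂ) *
        ∫ x in fundDomain b, orbitFun b κ x * conj (orbitFun b μ x) =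
      Nat.card (weyl b) * coeff b (orbitFun b κ) μ := by
  have hF := normMeasure_fundDomain b
  have hc0 := volume_cell_ne_zero (E := E) b
  have hct := volume_cell_ne_top (E := E) b
  have hcell : (volume (cell b)).toReal ≠ 0 := (ENNReal.toReal_pos hc0 hct).ne'
  rw [normMeasure_eq, Measure.smul_apply, smul_eq_mul] at hF
  have hF' := congrArg ENNReal.toReal hF
  simp only [ENNReal.toReal_mul, ENNReal.toReal_inv, ENNReal.toReal_natCast] at hF'
  have hcard : (Nat.card (weyl b) : ℝ) ≠ 0 := by exact_mod_cast Nat.card_pos.ne'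
  have hvol : (volume (fundDomain b)).toReal⁻¹ =
      Nat.card (weyl b) * (volume (cell b)).toReal⁻¹ := by
    rw [inv_mul_eq_iff_eq_mul₀ hcell] at hF'
    rw [hF', mul_inv, inv_inv, mul_comm]
  rw [coeff, domMeasure, normMeasure_eq, Measure.restrict_smul, integral_smul_measure, hvol,
    Complex.real_smul, ENNReal.toReal_inv]
  push_cast
  ring

omit [MeasurableSpace E] [BorelSpace E] in
lemma IsAntiInvariant.weyl {b : P.Base} {f : E → ℂ} (hf : IsAntiInvariant b f) {w : E ≃ₗ[ℝ] E}
    (hw : w ∈ weyl b) {q : E} (hq : q ∈ corootLattice b) (x : E) :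
    f (w x + q) = detC w * f x := by
  have := hf _ (affMk_mem b hw hq) x
  rwa [affMk_apply, linear_affMk] at this

/-- The orbit function expansion of a smooth anti-invariant function converges pointwise. -/
lemma hasSum_orbitFun {b : P.Base} {f : E → ℂ} (hf : ContDiff ℝ ∞ f)
    (ha : ∀ w ∈ weyl b, ∀ x, f (w x) = detC w * f x) (hp : IsPeriodic b f) (x : E) :
    HasSum (fun μ : strictWeights b => coeff b f μ * orbitFun b μ x) (f x) := by
  have hcoef : ∀ μ : strictWeights b, coeff b f μ = fourierCoef b f μ := fun μ =>
    coeff_eq_fourierCoef hf.continuous hp ha (strictWeights_subset_weights b μ.2)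
  have hsum : Summable fun μ : strictWeights b => ‖coeff b f μ‖ * Nat.card (weyl b) := by
    simp only [hcoef]
    exact (summable_fourierCoef hf hp).mul_right _
  have hbound : ∀ (μ : strictWeights b) x, ‖coeff b f μ * orbitFun b μ x‖ ≤
      ‖coeff b f μ‖ * Nat.card (weyl b) := fun μ x => by
    rw [norm_mul]
    exact mul_le_mul_of_nonneg_left (norm_orbitFun_le b μ x) (norm_nonneg _)
  have hsx : ∀ x, Summable fun μ : strictWeights b => coeff b f μ * orbitFun b μ x := fun x =>
    Summable.of_norm_bounded hsum fun μ => hbound μ x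
  let S : E → ℂ := fun x => ∑' μ : strictWeights b, coeff b f μ * orbitFun b μ x
  -- Orbit functions are bounded by `|W|` and the coefficients are absolutely summable, so the
  -- series converges uniformly.
  have hScont : Continuous S := continuous_tsum (fun μ => by fun_prop) hsum hbound
  have hSbdd : ∀ x, ‖S x‖ ≤ ∑' μ : strictWeights b, ‖coeff b f μ‖ * Nat.card (weyl b) :=
    fun x => tsum_of_norm_bounded hsum.hasSum fun μ => hbound μ x
  have hSp : IsPeriodic b S := fun q hq x => tsum_congr fun μ => by
    rw [orbitFun_add_lattice (strictWeights_subset_weights b μ.2) hq]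
  have hSa : ∀ w ∈ weyl b, ∀ x, S (w x) = detC w * S x := fun w hw x => by
    simp only [S]
    rw [← tsum_mul_left]
    refine tsum_congr fun μ => ?_
    rw [orbitFun_weyl_right hw]
    ring
  obtain ⟨C, hC⟩ := hp.bounded hf.continuous
  obtain ⟨m, hinj, -⟩ := exists_injective_label b
  have : Countable (strictWeights b) := hinj.countable
  have hconj : ∀ μ : E, Continuous fun x => conj (orbitFun b μ x) := fun μ =>
    Complex.continuous_conj.comp (continuous_orbitFun b μ)
  -- Absolute convergence permits termwise integration, and orthonormality picks out one
  -- coefficient.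
  have hScoeff : ∀ μ : strictWeights b, coeff b S μ = coeff b f μ := by
    classical
    intro μ
    have hterm : ∀ κ : strictWeights b, ∀ x,
        ‖coeff b f κ * orbitFun b κ x * conj (orbitFun b μ x)‖ ≤
          ‖coeff b f κ‖ * Nat.card (weyl b) * Nat.card (weyl b) := fun κ x => by
      rw [norm_mul, RCLike.norm_conj]
      exact mul_le_mul (hbound κ x) (norm_orbitFun_le b μ x) (norm_nonneg _) (by positivity)
    have hint : ∀ κ : strictWeights b, Integrable
        (fun x => coeff b f κ * orbitFun b κ x * conj (orbitFun b μ x)) (domMeasure b) := fun κ => by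
      have hcont : Continuous fun x => coeff b f κ * orbitFun b κ x * conj (orbitFun b μ x) :=
        (by fun_prop : Continuous fun x => coeff b f κ * orbitFun b κ x).mul (hconj μ)
      exact Integrable.of_bound hcont.aestronglyMeasurable _
        (Filter.Eventually.of_forall (hterm κ))
    have h1 := hasSum_integral_of_summable_integral_norm hint (by
      refine Summable.of_nonneg_of_le (fun κ => integral_nonneg fun _ => norm_nonneg _)
        (fun κ => ?_) ((hsum.mul_right (Nat.card (weyl b) : ℝ)).mul_right
          ((domMeasure b).real univ))
      rw [mul_comm _ ((domMeasure b).real univ), ← smul_eq_mul, ← integral_const]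
      exact integral_mono (hint κ).norm (integrable_const _) (hterm κ))
    have h2 : ∀ κ : strictWeights b,
        ∫ x, coeff b f κ * orbitFun b κ x * conj (orbitFun b μ x) ∂(domMeasure b) =
          if κ = μ then coeff b f μ else 0 := fun κ => by
      simp only [mul_assoc]
      rw [integral_const_mul]
      have h3 : ∫ x, orbitFun b κ x * conj (orbitFun b μ x) ∂(domMeasure b) = _ :=
        coeff_orbitFun κ μ
      rw [h3]
      split_ifs with h
      · rw [h, mul_one]
      · rw [mul_zero]
    simp only [h2, tsum_mul_right] at h1
    exact (h1.unique (hasSum_ite_eq μ _))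
  have hSf : S = f := by
    have hdiff : ∀ μ : strictWeights b,
        ∫ x, (S x - f x) * conj (orbitFun b μ x) ∂(domMeasure b) = 0 := fun μ => by
      have hi : ∀ {k : E → ℂ} {C : ℝ}, Continuous k → (∀ x, ‖k x‖ ≤ C) →
          Integrable (fun x => k x * conj (orbitFun b μ x)) (domMeasure b) := by
        intro k C hk hkC
        refine Integrable.of_bound (hk.mul (hconj μ)).aestronglyMeasurable
          (C * Nat.card (weyl b)) (Filter.Eventually.of_forall fun x => ?_)
        rw [norm_mul, RCLike.norm_conj]
        exact mul_le_mul (hkC x) (norm_orbitFun_le b μ x) (norm_nonneg _)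
          ((norm_nonneg _).trans (hkC x))
      simp only [sub_mul]
      rw [integral_sub (hi hScont hSbdd) (hi hf.continuous hC)]
      exact sub_eq_zero.mpr (hScoeff μ)
    have hcont : Continuous fun x => S x - f x := hScont.sub hf.continuous
    have hae := ae_eq_zero_of_forall_integral (b := b) (g := fun x => S x - f x)
      ((memLp_of_bounded hScont hSbdd).integrable one_le_two |>.sub
        ((memLp_of_bounded hf.continuous hC).integrable one_le_two)) hdiff
    have heq := Measure.eqOn_open_of_ae_eq hae (fundDomain_isOpen b) hcont.continuousOn
      continuousOn_const
    -- Agreement of `S` and `f` on `F` spreads by the common symmetries to every point off the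
    -- affine hyperplanes, hence almost everywhere, and then everywhere by continuity.
    refine (Continuous.ae_eq_iff_eq (normMeasure b) hScont hf.continuous).mp ?_
    have hreg : ∀ᵐ x ∂(normMeasure b), ∀ a : ι × ℤ, affVal P a x ≠ 0 :=
      ae_all_iff.mpr fun a => ae_affVal_ne_zero _ a
    filter_upwards [hreg] with x hx
    obtain ⟨w, hw, q, hq, h⟩ := exists_affineWeyl_mem_fundDomain b hx
    have h1 : S (w x + q) - f (w x + q) = 0 := heq h
    rw [hSp q hq, hp q hq, hSa w hw, ha w hw, ← mul_sub] at h1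
    have h2 : detC w ≠ 0 := fun h0 => by
      have := detC_mul_self hw
      simp [h0] at this
    exact sub_eq_zero.mp ((mul_eq_zero.mp h1).resolve_left h2)
  have h := (hsx x).hasSum
  rwa [show ∑' μ : strictWeights b, coeff b f μ * orbitFun b μ x = f x from congrFun hSf x] at h

end HilbertBasis

end OrbitFunction

end

open Classical in
theorem mainTheorem3 {ι E N : Type*} [Finite ι]
    [NormedAddCommGroup E] [InnerProductSpace ℝ E] [FiniteDimensional ℝ E]
    [MeasurableSpace E] [BorelSpace E] [AddCommGroup N] [Module ℝ N]
    (P : RootPairing ι ℝ E N) [P.IsRootSystem] [P.IsCrystallographic] [P.IsReduced]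
    (b : P.Base)
    (hinv : ∀ (i : ι) (x y : E), ⟪P.reflection i x, P.reflection i y⟫_ℝ = ⟪x, y⟫_ℝ) :
    -- orthogonality on `F`, for Lebesgue measure divided by the volume of `F`
    (∀ κ μ : OrbitFunction.strictWeights b,
      (((volume (OrbitFunction.fundDomain b)).toReal⁻¹ : ℝ) : ℂ) *
        ∫ x in OrbitFunction.fundDomain b,
          OrbitFunction.orbitFun b κ x * conj (OrbitFunction.orbitFun b μ x) =
      if κ = μ then (Nat.card (OrbitFunction.weyl b) : ℂ) else 0) ∧
    -- if the torus has volume one, then `|F| = |W|⁻¹` and the `φ_λ` are orthonormal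
    OrbitFunction.normMeasure b (OrbitFunction.fundDomain b) =
      (Nat.card (OrbitFunction.weyl b) : ℝ≥0∞)⁻¹ ∧
    (∀ κ μ : OrbitFunction.strictWeights b,
      ∫ x, OrbitFunction.orbitFun b κ x * conj (OrbitFunction.orbitFun b μ x)
        ∂(OrbitFunction.domMeasure b) = if κ = μ then 1 else 0) ∧
    -- expansion and Plancherel formula for smooth anti-invariant functions
    (∀ f : E → ℂ, ContDiff ℝ ∞ f → OrbitFunction.IsAntiInvariant b f →
      (∀ x ∈ frontier (OrbitFunction.fundDomain b), f x = 0) →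
      MemLp f 2 (OrbitFunction.domMeasure b) ∧
      (∀ x, HasSum (fun μ : OrbitFunction.strictWeights b =>
        OrbitFunction.coeff b f μ * OrbitFunction.orbitFun b μ x) (f x)) ∧
      HasSum (fun μ : OrbitFunction.strictWeights b => ‖OrbitFunction.coeff b f μ‖ ^ 2)
        (∫ x, ‖f x‖ ^ 2 ∂(OrbitFunction.domMeasure b))) ∧
    -- the `φ_λ` form an orthogonal (here: orthonormal) basis of the Hilbert space `L²₀(F)`
    ∃ B : HilbertBasis (OrbitFunction.strictWeights b) ℂ (OrbitFunction.L20 b),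
      ∀ μ : OrbitFunction.strictWeights b,
        ((B μ : Lp ℂ 2 (OrbitFunction.domMeasure b)) : E → ℂ)
          =ᵐ[OrbitFunction.domMeasure b] OrbitFunction.orbitFun b μ := by
  have : OrbitFunction.IsEuclidean P := ⟨hinv⟩
  refine ⟨fun κ μ => ?_, OrbitFunction.normMeasure_fundDomain b,
    fun κ μ => OrbitFunction.coeff_orbitFun κ μ, fun f hf ha h0 => ?_,
    OrbitFunction.orbitBasis b, fun μ => ?_⟩
  · rw [OrbitFunction.volume_orthogonality, OrbitFunction.coeff_orbitFun]
    split_ifs <;> simp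
  · have hp : OrbitFunction.IsPeriodic b f := fun q hq x => by
      simpa [OrbitFunction.detC_one] using ha.weyl (one_mem _) hq x
    have haw : ∀ w ∈ OrbitFunction.weyl b, ∀ x, f (w x) = OrbitFunction.detC w * f x :=
      fun w hw x => by simpa using ha.weyl hw (zero_mem _) x
    obtain ⟨C, hC⟩ := hp.bounded hf.continuous
    have hmem := OrbitFunction.memLp_of_bounded (b := b) hf.continuous hC
    exact ⟨hmem, OrbitFunction.hasSum_orbitFun hf haw hp,
      OrbitFunction.hasSum_norm_coeff_sq hf.continuous h0 hmem⟩
  · rw [OrbitFunction.orbitBasis_apply]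
    exact (OrbitFunction.memLp_orbitFun b μ).coeFn_toLp
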